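/- Let $\boldsymbol{k}$ be an algebraically closed field of characteristic different from $2$, let $R=\boldsymbol{k}[x_0,\dots,x_n]$ with its standard grading, and let $\boldsymbol{E}$, $\boldsymbol{G}$ be finitely generated graded $R$-modules with minimal graded free resolutions $$\cdots\to E^2\xrightarrow{e_2}E^1\xrightarrow{e_1}E^0\to\boldsymbol{E}\to0,\qquad \cdots\to G^2\xrightarrow{g_2}G^1\xrightarrow{g_1}G^0\to\boldsymbol{G}\to0 .$$ Denote by $\beta_{i,j}$ the graded Betti numbers (the number of summands $R(-j)$ in the $i$-th term of the minimal resolution). Let $m\in\mathbb{Z}$, and assume that $\boldsymbol{E}$ and $\boldsymbol{G}$ are $m$-linearly presented up to order $1$ and $2$ respectively, that is, $E^i\simeq R(-m-i)^{\beta_{i,m+i}(\boldsymbol{E})}$ for $i\le 1$ and $G^i\simeq R(-m-i)^{\beta_{i,m+i}(\boldsymbol{G})}$ for $i\le 2$. Let $\mu:\boldsymbol{E}\to\boldsymbol{G}$ be a surjective morphism of graded modules, let $\mu^i:E^i\to G^i$ $(i=0,1)$ be the induced maps, and let $\nu^2:\operatorname{im}(e_2)\to\operatorname{im}(g_2)$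 be the restriction of $\mu^1$. Suppose that - $\mu^1$ is surjective; - the sheaves $E=\tilde{\boldsymbol{E}}$ and $G=\tilde{\boldsymbol{G}}$ on $\mathbb{P}^n=\operatorname{Proj}R$ are vector bundles of ranks $r$ and $s$; - $\operatorname{coker}(\nu^2)$ is an Artinian $R$-module. Set $\boldsymbol{F}=\ker(\mu)$, $a=\beta_{0,m}(\boldsymbol{E})-\beta_{0,m}(\boldsymbol{G})$ and $b=\beta_{1,m+1}(\boldsymbol{E})-\beta_{1,m+1}(\boldsymbol{G})$. Then $\boldsymbol{F}$ has a minimal graded free presentation, and in every minimal graded free presentation $F^1\to F^0\to\boldsymbol{F}\to 0$ all generators have degree $m$, and the linear part of the presentation matrix (its columns of degree $m+1$) is an $a\times b$ matrix $A$ of linear forms which has constant corank $r-s$: for every $p\in\boldsymbol{k}^{n+1}\setminus\{0\}$ one has $a-\operatorname{rank}A(p)=r-s$. Moreover, the morphism $\tilde{\boldsymbol{F}}\to E$ induced by the inclusion $\boldsymbol{F}\subset\boldsymbol{E}$ identifies $\tilde{\boldsymbol{F}}$ with the kernel of $\tilde\mu:E\to G$. -/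

import Mathlib

open CategoryTheory AlgebraicGeometry TopologicalSpace Opposite

universe u

noncomputable section

/-! ### Graded modules over an `ℕ`-graded ring -/

/-- A `ℤ`-grading `M = ⨁ⱼ Mⱼ` on a module `M` over the `ℕ`-graded ring `A = ⨁ᵢ 𝒜ᵢ`. -/
structure ModuleGrading {A σ : Type*} [CommRing A] [SetLike σ A] [AddSubgroupClass σ A]
    (𝒜 : ℕ → σ) (M : Type*) [AddCommGroup M] [Module A M] where
  /-- the graded pieces -/
  piece : ℤ → AddSubgroup M
  smul_mem : ∀ {i : ℕ} {j : ℤ} {a : A} {x : M}, a ∈ 𝒜 i → x ∈ piece j → a • x ∈ piece (i + j)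
  isInternal : DirectSum.IsInternal piece

namespace ModuleGrading

variable {A σ : Type*} [CommRing A] [SetLike σ A] [AddSubgroupClass σ A] {𝒜 : ℕ → σ}
  {M N : Type*} [AddCommGroup M] [Module A M] [AddCommGroup N] [Module A N]

/-- A linear map is a morphism of graded modules if it preserves degrees. -/
def IsGradedHom (ℳ : ModuleGrading 𝒜 M) (𝒩 : ModuleGrading 𝒜 N) (f : M →ₗ[A] N) : Prop :=
  ∀ j, ∀ x ∈ ℳ.piece j, f x ∈ 𝒩.piece j

/-- The grading induced on the kernel of a morphism of graded modules. -/
def ker (ℳ : ModuleGrading 𝒜 M) (𝒩 : ModuleGrading 𝒜 N) (f : M →ₗ[A] N)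
    (hf : IsGradedHom ℳ 𝒩 f) : ModuleGrading 𝒜 (LinearMap.ker f) where
  piece j := (ℳ.piece j).comap (LinearMap.ker f).subtype.toAddMonoidHom
  smul_mem ha hx := ℳ.smul_mem ha hx
  isInternal := by
    classical
    have hM := ℳ.isInternal
    have hN := 𝒩.isInternal
    constructor
    · -- injectivity
      rw [injective_iff_map_eq_zero]
      intro y hy
      let φ : ∀ j, ((ℳ.piece j).comap (LinearMap.ker f).subtype.toAddMonoidHom) →+ ℳ.piece j :=
        fun j => ⟨⟨fun z => ⟨z.1.1, z.2⟩, rfl⟩, fun _ _ => rfl⟩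
      have key : ∀ y : DirectSum ℤ fun j =>
          ((ℳ.piece j).comap (LinearMap.ker f).subtype.toAddMonoidHom),
          DirectSum.coeAddMonoidHom ℳ.piece (DirectSum.map φ y) =
            (DirectSum.coeAddMonoidHom (fun j =>
              (ℳ.piece j).comap (LinearMap.ker f).subtype.toAddMonoidHom) y).1 := by
        intro y
        induction y using DirectSum.induction_on with
        | zero => simp
        | of i x => simp [φ]
        | add a b ha hb => simp [ha, hb]
      have h0 : DirectSum.map φ y = 0 := by
        apply hM.1
        rw [key, hy]; simp
      ext j
      have := congrArg (fun t => ((t j : ℳ.piece j) : M)) h0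
      simpa [φ] using this
    · -- surjectivity
      rintro ⟨x, hx⟩
      obtain ⟨z, rfl⟩ := hM.2 x
      let ψ : ∀ j, ℳ.piece j →+ 𝒩.piece j :=
        fun j => ⟨⟨fun w => ⟨f w.1, hf j _ w.2⟩, by simp⟩, fun a b => by ext; simp⟩
      have key : ∀ y, DirectSum.coeAddMonoidHom 𝒩.piece (DirectSum.map ψ y) =
            f (DirectSum.coeAddMonoidHom ℳ.piece y) := by
        intro y
        induction y using DirectSum.induction_on with
        | zero => simp
        | of i x => simp [ψ]
        | add a b ha hb => simp [ha, hb]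
      have h0 : DirectSum.map ψ z = 0 := by
        apply hN.1
        rw [key, LinearMap.mem_ker.1 hx]; simp
      have h1 : ∀ j, f (z j) = 0 := fun j => by
        have := congrArg (fun t => ((t j : 𝒩.piece j) : N)) h0
        simpa [ψ] using this
      refine ⟨∑ j ∈ z.support, DirectSum.of _ j ⟨⟨(z j : M), h1 j⟩, (z j).2⟩, ?_⟩
      apply Subtype.ext
      rw [map_sum]
      simp only [DirectSum.coeAddMonoidHom_of, AddSubmonoidClass.coe_finsetSum]
      conv_rhs => rw [← DirectSum.sum_support_of z]
      rw [map_sum]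
      simp

theorem isGradedHom_ker_subtype (ℳ : ModuleGrading 𝒜 M) (𝒩 : ModuleGrading 𝒜 N) (f : M →ₗ[A] N)
    (hf : IsGradedHom ℳ 𝒩 f) : (ℳ.ker 𝒩 f hf).IsGradedHom ℳ (LinearMap.ker f).subtype :=
  fun _ _ hx => hx

end ModuleGrading

/-! ### The sheaf `M~` on `Proj A` associated with a graded module -/

namespace ProjTilde

variable {A σ : Type u} [CommRing A] [SetLike σ A] [AddSubgroupClass σ A] {𝒜 : ℕ → σ}
  [GradedRing 𝒜] {M N : Type u} [AddCommGroup M] [Module A M] [AddCommGroup N] [Module A N]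

/-- The localization `M_𝔭` of the module `M` at the homogeneous prime `𝔭`. -/
abbrev LocAt (𝒜 : ℕ → σ) [GradedRing 𝒜] (M : Type u) [AddCommGroup M] [Module A M]
    (x : ProjectiveSpectrum 𝒜) : Type u :=
  LocalizedModule x.asHomogeneousIdeal.toIdeal.primeCompl M

/-- The degree-zero part `A_(𝔭)` of `A_𝔭`; this is the stalk of the structure sheaf of `Proj A`. -/
abbrev RingAt (𝒜 : ℕ → σ) [GradedRing 𝒜] (x : ProjectiveSpectrum 𝒜) : Type u :=
  HomogeneousLocalization.AtPrime 𝒜 x.asHomogeneousIdeal.toIdeal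

/-- `A_(𝔭)`, being a subring of `A_𝔭`, acts on `M_𝔭`. -/
def smulAt {x : ProjectiveSpectrum 𝒜} (a : RingAt 𝒜 x) (f : LocAt 𝒜 M x) : LocAt 𝒜 M x :=
  (a.val : Localization.AtPrime x.asHomogeneousIdeal.toIdeal) • f

/-- The element `f` of `M_𝔭` is the fraction `m / s`, where `s ∉ 𝔭`. -/
def IsFracAt {x : ProjectiveSpectrum 𝒜} (m : M) (s : A) (f : LocAt 𝒜 M x) : Prop :=
  ∃ hs : s ∈ x.asHomogeneousIdeal.toIdeal.primeCompl, f = LocalizedModule.mk m ⟨s, hs⟩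

theorem IsFracAt.zero {x : ProjectiveSpectrum 𝒜} : IsFracAt (0 : M) 1 (0 : LocAt 𝒜 M x) :=
  ⟨one_mem _, (LocalizedModule.zero_mk _).symm⟩

theorem IsFracAt.add {x : ProjectiveSpectrum 𝒜} {m n : M} {s t : A} {f g : LocAt 𝒜 M x}
    (hf : IsFracAt m s f) (hg : IsFracAt n t g) : IsFracAt (t • m + s • n) (s * t) (f + g) := by
  obtain ⟨hs, rfl⟩ := hf
  obtain ⟨ht, rfl⟩ := hg
  exact ⟨mul_mem hs ht, LocalizedModule.mk_add_mk ..⟩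

theorem IsFracAt.neg {x : ProjectiveSpectrum 𝒜} {m : M} {s : A} {f : LocAt 𝒜 M x}
    (hf : IsFracAt m s f) : IsFracAt (-m) s (-f) := by
  obtain ⟨hs, rfl⟩ := hf
  exact ⟨hs, LocalizedModule.mk_neg.symm⟩

theorem IsFracAt.smul {x : ProjectiveSpectrum 𝒜} {m : M} {s : A} {f : LocAt 𝒜 M x}
    (hf : IsFracAt m s f) {i : ℕ} {r t : 𝒜 i}
    (ht : (t : A) ∈ x.asHomogeneousIdeal.toIdeal.primeCompl) :
    IsFracAt ((r : A) • m) (t * s)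
      (smulAt (HomogeneousLocalization.mk ⟨i, r, t, ht⟩ : RingAt 𝒜 x) f) := by
  obtain ⟨hs, rfl⟩ := hf
  exact ⟨mul_mem ht hs, LocalizedModule.mk_smul_mk ..⟩

/-- The map `M_𝔭 → N_𝔭` induced by a linear map `M → N`. -/
def mapAt (x : ProjectiveSpectrum 𝒜) (φ : M →ₗ[A] N) : LocAt 𝒜 M x →+ LocAt 𝒜 N x :=
  (LocalizedModule.map x.asHomogeneousIdeal.toIdeal.primeCompl φ).toAddMonoidHom

theorem IsFracAt.map {x : ProjectiveSpectrum 𝒜} {m : M} {s : A} {f : LocAt 𝒜 M x}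
    (hf : IsFracAt m s f) (φ : M →ₗ[A] N) : IsFracAt (φ m) s (mapAt x φ f) := by
  obtain ⟨hs, rfl⟩ := hf
  exact ⟨hs, LocalizedModule.map_mk ..⟩

theorem mapAt_smulAt {x : ProjectiveSpectrum 𝒜} (φ : M →ₗ[A] N) (a : RingAt 𝒜 x)
    (f : LocAt 𝒜 M x) : mapAt x φ (smulAt a f) = smulAt a (mapAt x φ f) :=
  (LocalizedModule.map x.asHomogeneousIdeal.toIdeal.primeCompl φ).map_smul a.val f

section Laws

variable {x : ProjectiveSpectrum 𝒜} (a b : RingAt 𝒜 x) (f g : LocAt 𝒜 M x)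

theorem one_smulAt : smulAt (1 : RingAt 𝒜 x) f = f := by simp [smulAt]

theorem mul_smulAt : smulAt (a * b) f = smulAt a (smulAt b f) := by simp [smulAt, mul_smul]

theorem smulAt_zero : smulAt a (0 : LocAt 𝒜 M x) = 0 := by simp [smulAt]

theorem smulAt_add : smulAt a (f + g) = smulAt a f + smulAt a g := by simp [smulAt]

theorem add_smulAt : smulAt (a + b) f = smulAt a f + smulAt b f := by simp [smulAt, add_smul]

theorem zero_smulAt : smulAt (0 : RingAt 𝒜 x) f = 0 := by simp [smulAt]

end Laws

/-- A dependent function `f` on `U` is a homogeneous fraction of degree zero if `f = m / s` on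
all of `U` for homogeneous `m ∈ M` and `s ∈ A` of the same degree, `s` vanishing nowhere on `U`. -/
def IsFraction (ℳ : ModuleGrading 𝒜 M) {U : Opens (ProjectiveSpectrum.top 𝒜)}
    (f : ∀ x : U, LocAt 𝒜 M x.1) : Prop :=
  ∃ (i : ℕ) (m : M) (s : A), m ∈ ℳ.piece i ∧ s ∈ 𝒜 i ∧ ∀ x : U, IsFracAt m s (f x)

/-- "Being a homogeneous fraction of degree zero" is stable under restriction. -/
def isFractionPrelocal (ℳ : ModuleGrading 𝒜 M) :
    TopCat.PrelocalPredicate fun x : ProjectiveSpectrum.top 𝒜 => LocAt 𝒜 M x where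
  pred f := IsFraction ℳ f
  res := by
    rintro V U i f ⟨j, m, s, hm, hs, w⟩
    exact ⟨j, m, s, hm, hs, fun x => w (i x)⟩

/-- The dependent functions which are locally homogeneous fractions of degree zero. -/
def isLocallyFraction (ℳ : ModuleGrading 𝒜 M) :
    TopCat.LocalPredicate fun x : ProjectiveSpectrum.top 𝒜 => LocAt 𝒜 M x :=
  (isFractionPrelocal ℳ).sheafify

/-- The sheaf of sets of dependent functions which are locally homogeneous fractions of degree
zero. -/
def sheafInType (ℳ : ModuleGrading 𝒜 M) : TopCat.Sheaf (Type u) (ProjectiveSpectrum.top 𝒜) :=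
  TopCat.subsheafToTypes (isLocallyFraction ℳ)

/-- The sections over `U` form a group under pointwise addition. -/
def sections (ℳ : ModuleGrading 𝒜 M) (U : (Opens (ProjectiveSpectrum.top 𝒜))ᵒᵖ) :
    AddSubgroup (∀ x : U.unop, LocAt 𝒜 M x.1) where
  carrier := {f | (isLocallyFraction ℳ).pred f}
  zero_mem' x := ⟨U.unop, x.2, 𝟙 _, 0, 0, 1, zero_mem _, SetLike.GradedOne.one_mem,
    fun _ => IsFracAt.zero⟩
  add_mem' {a b} ha hb x := by
    obtain ⟨Va, ma, ia, da, ra, sa, hra, hsa, wa⟩ := ha x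
    obtain ⟨Vb, mb, ib, db, rb, sb, hrb, hsb, wb⟩ := hb x
    refine ⟨Va ⊓ Vb, ⟨ma, mb⟩, Opens.infLELeft _ _ ≫ ia, da + db, sb • ra + sa • rb, sa * sb,
      add_mem ?_ ?_, SetLike.GradedMul.mul_mem hsa hsb,
      fun y => (wa ⟨y.1, y.2.1⟩).add (wb ⟨y.1, y.2.2⟩)⟩
    · have := ℳ.smul_mem hsb hra
      rwa [add_comm, ← Nat.cast_add] at this
    · have := ℳ.smul_mem hsa hrb
      rwa [← Nat.cast_add] at this
  neg_mem' {a} ha x := by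
    obtain ⟨V, hx, i, d, r, s, hr, hs, w⟩ := ha x
    exact ⟨V, hx, i, d, -r, s, neg_mem hr, hs, fun y => (w y).neg⟩

instance (ℳ : ModuleGrading 𝒜 M) (U : (Opens (ProjectiveSpectrum.top 𝒜))ᵒᵖ) :
    AddCommGroup ((sheafInType ℳ).1.obj U) :=
  (sections ℳ U).toAddCommGroup

/-- Sections of the structure sheaf act pointwise. -/
instance (ℳ : ModuleGrading 𝒜 M) (U : (Opens (ProjectiveSpectrum.top 𝒜))ᵒᵖ) :
    SMul ((ProjectiveSpectrum.Proj.structureSheaf 𝒜).1.obj U) ((sheafInType ℳ).1.obj U) where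
  smul a f := ⟨fun x => smulAt (a.1 x) (f.1 x), fun x => by
    obtain ⟨V, hxV, hVU, i, ⟨r, hr⟩, ⟨t, ht⟩, hn, w⟩ := a.2 x
    obtain ⟨W, hxW, hWU, j, m, s, hm, hs, w'⟩ := f.2 x
    refine ⟨V ⊓ W, ⟨hxV, hxW⟩, Opens.infLELeft _ _ ≫ hVU, i + j, r • m, t * s,
      ?_, SetLike.GradedMul.mul_mem ht hs, fun y => ?_⟩
    · have := ℳ.smul_mem hr hm
      rwa [← Nat.cast_add] at this
    · have h := (w' ⟨y.1, y.2.2⟩).smul (r := ⟨r, hr⟩) (t := ⟨t, ht⟩) (hn ⟨y.1, y.2.1⟩)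
      have e := w ⟨y.1, y.2.1⟩
      exact (congrArg (fun c => IsFracAt (r • m) (t * s) (smulAt c (f.1 ⟨y.1, _⟩))) e).mpr h⟩

instance (ℳ : ModuleGrading 𝒜 M) (U : (Opens (ProjectiveSpectrum.top 𝒜))ᵒᵖ) :
    Module ((ProjectiveSpectrum.Proj.structureSheaf 𝒜).1.obj U) ((sheafInType ℳ).1.obj U) where
  one_smul f := Subtype.ext <| funext fun x => one_smulAt (f.1 x)
  mul_smul a b f := Subtype.ext <| funext fun x => mul_smulAt (a.1 x) (b.1 x) (f.1 x)
  smul_zero a := Subtype.ext <| funext fun x => smulAt_zero (a.1 x)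
  smul_add a f g := Subtype.ext <| funext fun x => smulAt_add (a.1 x) (f.1 x) (g.1 x)
  add_smul a b f := Subtype.ext <| funext fun x => add_smulAt (a.1 x) (b.1 x) (f.1 x)
  zero_smul f := Subtype.ext <| funext fun x => zero_smulAt (f.1 x)

/-- The presheaf of abelian groups underlying `M~`. -/
def presheafAb (ℳ : ModuleGrading 𝒜 M) : (Opens (ProjectiveSpectrum.top 𝒜))ᵒᵖ ⥤ Ab.{u} where
  obj U := AddCommGrpCat.of ((sheafInType ℳ).1.obj U)
  map i := AddCommGrpCat.ofHom
    { toFun := (sheafInType ℳ).1.map i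
      map_zero' := rfl
      map_add' := fun _ _ => rfl }

instance (ℳ : ModuleGrading 𝒜 M) (U : (Opens (ProjectiveSpectrum.top 𝒜))ᵒᵖ) :
    Module (((ProjectiveSpectrum.Proj.structureSheaf 𝒜).1 ⋙ forget₂ CommRingCat RingCat).obj U)
      ((presheafAb ℳ).obj U) :=
  inferInstanceAs (Module ((ProjectiveSpectrum.Proj.structureSheaf 𝒜).1.obj U)
      ((sheafInType ℳ).1.obj U))

/-- `M~` as a presheaf of modules over the structure sheaf of `Proj A`. -/
def presheafOfModules (ℳ : ModuleGrading 𝒜 M) :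
    PresheafOfModules
      ((ProjectiveSpectrum.Proj.structureSheaf 𝒜).1 ⋙ forget₂ CommRingCat RingCat) :=
  PresheafOfModules.ofPresheaf (presheafAb ℳ) fun _ _ _ _ _ => rfl

/-- The sheaf of modules `M~` on `Proj A` associated with a graded `A`-module `M`: its sections
over `U` are the functions on `U` with values in the `M_𝔭` which are locally of the form `m / s`
with `m` and `s` homogeneous of the same degree. -/
def tilde (ℳ : ModuleGrading 𝒜 M) : (Proj 𝒜).Modules where
  val := presheafOfModules ℳ
  isSheaf := (TopCat.Presheaf.isSheaf_iff_isSheaf_comp (forget AddCommGrpCat) (presheafAb ℳ)).2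
    (sheafInType ℳ).2

/-- The map on sections induced by a morphism of graded modules. -/
def mapSections {ℳ : ModuleGrading 𝒜 M} {𝒩 : ModuleGrading 𝒜 N} (φ : M →ₗ[A] N)
    (hφ : ℳ.IsGradedHom 𝒩 φ) (U : (Opens (ProjectiveSpectrum.top 𝒜))ᵒᵖ) :
    (sheafInType ℳ).1.obj U →+ (sheafInType 𝒩).1.obj U where
  toFun f := ⟨fun x => mapAt x.1 φ (f.1 x), fun x => by
    obtain ⟨V, hx, i, d, r, s, hr, hs, w⟩ := f.2 x
    exact ⟨V, hx, i, d, φ r, s, hφ _ _ hr, hs, fun y => (w y).map φ⟩⟩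
  map_zero' := Subtype.ext <| funext fun x => map_zero (mapAt x.1 φ)
  map_add' f g := Subtype.ext <| funext fun x => map_add (mapAt x.1 φ) (f.1 x) (g.1 x)

/-- The morphism `M~ → N~` induced by a morphism `M → N` of graded modules, which applies
`M_𝔭 → N_𝔭` pointwise to sections. -/
def tildeMap (ℳ : ModuleGrading 𝒜 M) (𝒩 : ModuleGrading 𝒜 N) (φ : M →ₗ[A] N)
    (hφ : ℳ.IsGradedHom 𝒩 φ) : tilde ℳ ⟶ tilde 𝒩 where
  val := PresheafOfModules.homMk (M₁ := presheafOfModules ℳ) (M₂ := presheafOfModules 𝒩)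
    { app U := AddCommGrpCat.ofHom (mapSections φ hφ U)
      naturality _ _ _ := rfl }
    fun U a (f : (sheafInType ℳ).1.obj U) =>
      Subtype.ext <| funext fun x => mapAt_smulAt φ (a.1 x) (f.1 x)

end ProjTilde

/-! ### Vector bundles -/

/-- A sheaf of modules `ℱ` on a scheme is a vector bundle of rank `r` if it is locally isomorphic
to `𝒪^r`: around every point there are `r` sections of `ℱ` over an open set `U` (a frame, that is
a homomorphism `𝒪_U^r → ℱ|_U`) which form a basis of `ℱ(V)` over `𝒪(V)` for all open `V ⊆ U`. -/
def IsVectorBundleOfRank {X : Scheme.{u}} (ℱ : X.Modules) (r : ℕ) : Prop :=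
  ∀ x : X, ∃ U : X.Opens, x ∈ U ∧ ∃ s : Fin r → Γ(ℱ, U), ∀ (V : X.Opens) (h : V ≤ U),
    LinearIndependent Γ(X, V) (fun i => ℱ.presheaf.map (homOfLE h).op (s i)) ∧
      Submodule.span Γ(X, V) (Set.range fun i => ℱ.presheaf.map (homOfLE h).op (s i)) = ⊤

/-! ### Minimal graded free resolutions over a polynomial ring -/

/-- The polynomial ring `R = k[x₀, …, xₙ]`. -/
abbrev PolyRing (k : Type u) [Field k] (n : ℕ) : Type u := MvPolynomial (Fin (n + 1)) k

/-- The standard grading of `R = k[x₀, …, xₙ]`. -/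
abbrev stdGrading (k : Type u) [Field k] (n : ℕ) : ℕ → Submodule k (PolyRing k n) :=
  MvPolynomial.homogeneousSubmodule (Fin (n + 1)) k

instance instGradedRingStdGrading (k : Type u) [Field k] (n : ℕ) : GradedRing (stdGrading k n) :=
  MvPolynomial.gradedAlgebra

/-- `p` is homogeneous of degree `e`, where `e` is an integer: only `p = 0` if `e < 0`. -/
def IsHomogeneousOfDegree {k : Type u} [Field k] {n : ℕ} (p : PolyRing k n) (e : ℤ) : Prop :=
  p = 0 ∨ ∃ d : ℕ, (d : ℤ) = e ∧ p.IsHomogeneous d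

section Resolutions

variable {k : Type u} [Field k] {n : ℕ} {M : Type u} [AddCommGroup M] [Module (PolyRing k n) M]
  {N : Type u} [AddCommGroup N] [Module (PolyRing k n) N]

/-- A minimal graded free resolution `⋯ → F₂ → F₁ → F₀ → M → 0` of a graded `R`-module, with
`Fᵢ = ⨁ₗ R(-deg i l)` of finite rank. The differentials are given by their matrices in the
standard bases; minimality means that their entries lie in the ideal `(x₀, …, xₙ)`. -/
structure MinimalFreeResolution (ℳ : ModuleGrading (stdGrading k n) M) where
  /-- the rank of `Fᵢ` -/
  rk : ℕ → ℕ
  /-- the degrees of the basis elements of `Fᵢ` -/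
  deg : ∀ i, Fin (rk i) → ℤ
  /-- the images in `M` of the basis elements of `F₀` -/
  gen : Fin (rk 0) → M
  /-- the matrix of `Fᵢ₊₁ → Fᵢ` -/
  d : ∀ i, Matrix (Fin (rk i)) (Fin (rk (i + 1))) (PolyRing k n)
  gen_mem : ∀ l, gen l ∈ ℳ.piece (deg 0 l)
  d_homogeneous : ∀ i l j, IsHomogeneousOfDegree (d i l j) (deg (i + 1) j - deg i l)
  d_minimal : ∀ i l j, MvPolynomial.constantCoeff (d i l j) = 0
  surjective : Function.Surjective (Fintype.linearCombination (PolyRing k n) gen)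
  exact_zero : LinearMap.range (d 0).mulVecLin =
    LinearMap.ker (Fintype.linearCombination (PolyRing k n) gen)
  exact_succ : ∀ i, LinearMap.range (d (i + 1)).mulVecLin = LinearMap.ker (d i).mulVecLin

namespace MinimalFreeResolution

variable {ℳ : ModuleGrading (stdGrading k n) M} {𝒩 : ModuleGrading (stdGrading k n) N}

/-- The augmentation `F₀ → M`. -/
def aug (P : MinimalFreeResolution ℳ) : (Fin (P.rk 0) → PolyRing k n) →ₗ[PolyRing k n] M :=
  Fintype.linearCombination (PolyRing k n) P.gen

/-- The graded Betti number `β_{i,j}`: the number of summands `R(-j)` of `Fᵢ`. -/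
def betti (P : MinimalFreeResolution ℳ) (i : ℕ) (j : ℤ) : ℕ :=
  Fintype.card {l : Fin (P.rk i) // P.deg i l = j}

/-- The module is `m`-linearly presented up to order `N`: it is generated in degree `m` and the
first `N` maps of the resolution are matrices of linear forms, that is, `Fᵢ = R(-m-i)^{βᵢ}` for
all `i ≤ N`. -/
def IsLinearUpTo (P : MinimalFreeResolution ℳ) (m : ℤ) (N : ℕ) : Prop :=
  ∀ i ≤ N, ∀ l, P.deg i l = m + i

/-- The maps `μ⁰ : E⁰ → G⁰` and `μ¹ : E¹ → G¹`, homogeneous of degree zero, induced on minimal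
resolutions by a morphism `μ : E → G`. -/
structure Lift (P : MinimalFreeResolution ℳ) (Q : MinimalFreeResolution 𝒩)
    (μ : M →ₗ[PolyRing k n] N) where
  /-- the matrix of `μ⁰` -/
  mu0 : Matrix (Fin (Q.rk 0)) (Fin (P.rk 0)) (PolyRing k n)
  /-- the matrix of `μ¹` -/
  mu1 : Matrix (Fin (Q.rk 1)) (Fin (P.rk 1)) (PolyRing k n)
  mu0_homogeneous : ∀ l j, IsHomogeneousOfDegree (mu0 l j) (P.deg 0 j - Q.deg 0 l)
  mu1_homogeneous : ∀ l j, IsHomogeneousOfDegree (mu1 l j) (P.deg 1 j - Q.deg 1 l)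
  comm_zero : Q.aug ∘ₗ mu0.mulVecLin = μ ∘ₗ P.aug
  comm_one : Q.d 0 * mu1 = mu0 * P.d 0

namespace Lift

variable {P : MinimalFreeResolution ℳ} {Q : MinimalFreeResolution 𝒩} {μ : M →ₗ[PolyRing k n] N}

theorem mu1_mem (c : Lift P Q μ) : ∀ v ∈ LinearMap.range (P.d 1).mulVecLin,
    c.mu1.mulVecLin v ∈ LinearMap.range (Q.d 1).mulVecLin := by
  intro v hv
  have hv' : (P.d 0).mulVec v = 0 := by
    have := P.exact_succ 0 ▸ hv
    simpa using this
  have : c.mu1.mulVecLin v ∈ LinearMap.ker (Q.d 0).mulVecLin := by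
    rw [LinearMap.mem_ker, Matrix.mulVecLin_apply, Matrix.mulVecLin_apply, Matrix.mulVec_mulVec,
      c.comm_one, ← Matrix.mulVec_mulVec, hv', Matrix.mulVec_zero]
  exact Q.exact_succ 0 ▸ this

/-- The map `ν² : J² → K²` induced by `μ¹` on the second syzygy modules, the images `J²` and `K²`
of `E² → E¹` and `G² → G¹`. -/
def nu2 (c : Lift P Q μ) :
    LinearMap.range (P.d 1).mulVecLin →ₗ[PolyRing k n] LinearMap.range (Q.d 1).mulVecLin :=
  c.mu1.mulVecLin.restrict c.mu1_mem

end Lift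

end MinimalFreeResolution

/-- A minimal graded free presentation `F₁ → F₀ → M → 0` of a graded `R`-module, with
`F₀ = ⨁ₗ R(-deg0 l)` and `F₁ = ⨁ⱼ R(-deg1 j)` of finite rank; minimality means that the entries
of the presentation matrix, and of all its syzygies, lie in the ideal `(x₀, …, xₙ)`. -/
structure MinimalPresentation (ℳ : ModuleGrading (stdGrading k n) M) where
  /-- the number of generators -/
  rk0 : ℕ
  /-- the number of relations -/
  rk1 : ℕ
  /-- the degrees of the generators -/
  deg0 : Fin rk0 → ℤ
  /-- the degrees of the relations -/
  deg1 : Fin rk1 → ℤ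
  /-- the generators -/
  gen : Fin rk0 → M
  /-- the presentation matrix -/
  mat : Matrix (Fin rk0) (Fin rk1) (PolyRing k n)
  gen_mem : ∀ l, gen l ∈ ℳ.piece (deg0 l)
  mat_homogeneous : ∀ l j, IsHomogeneousOfDegree (mat l j) (deg1 j - deg0 l)
  surjective : Function.Surjective (Fintype.linearCombination (PolyRing k n) gen)
  exact : LinearMap.range mat.mulVecLin =
    LinearMap.ker (Fintype.linearCombination (PolyRing k n) gen)
  mat_minimal : ∀ l j, MvPolynomial.constantCoeff (mat l j) = 0
  syz_minimal : ∀ v ∈ LinearMap.ker mat.mulVecLin, ∀ j, MvPolynomial.constantCoeff (v j) = 0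

/-- The linear part of a presentation matrix on the generators of degree `m`: the block
`R(-m-1)^b → R(-m)^a` formed by the rows of degree `m` and the columns of degree `m + 1`. -/
def MinimalPresentation.linearPart {ℳ : ModuleGrading (stdGrading k n) M}
    (P : MinimalPresentation ℳ) (m : ℤ) :
    Matrix {l : Fin P.rk0 // P.deg0 l = m} {j : Fin P.rk1 // P.deg1 j = m + 1} (PolyRing k n) :=
  P.mat.submatrix Subtype.val Subtype.val

end Resolutions

end

/-! Because `E` and `G` are linearly presented in the same degrees, `μ⁰` and `μ¹` have constant
entries. Call these matrices over `k` `B₀` (`const0`) and `B₁` (`const1`); both are surjective, the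
first by Nakayama. Let `d_E`, `d_G` be the linear presentation matrices, so that `d_G B₁ = B₀ d_E`.

The kernel of `μ`. If `v` represents an element of `F`, then `B₀ v` is a relation of `G`.
Surjectivity of `μ¹` writes it as `d_G B₁ w = B₀ d_E w`, so `v - d_E w` represents the same element
and lies in `ker B₀`. Hence `F` is generated in degree `m`. The generators of any minimal
presentation form a basis `Γ` of `ker B₀` (`exists_generator_matrix`), and its linear relations
correspond to a basis `Ω` of `ker B₁` with `d_E Ω = Γ A` (`exists_relation_matrix`). Counting
dimensions gives `a` and `b`.

The rank at `p`. As `Γ` is injective, `rank A(p) = dim d_E(p)(ker B₁)`. The key claim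
(`map_ker_const1_eq`) is that `ker B₁` may be replaced by the larger space `ker (B₀ d_E(p))`. Take
`v` in the latter, so that `d_G(p)` kills `B₁ v`. Since the sheaf of `G` is a bundle, `B₁ v` is the
value at `p` of a syzygy `w` of `G` (`exists_syzygy_eval_eq`). Since `coker ν²` is Artinian, some
`xᵢ^t w` with `pᵢ ≠ 0` lifts to a syzygy `z` of `E` (`exists_pow_smul_eq`). Subtracting `pᵢ^(-t)
z(p)` moves `v` into `ker B₁` without changing `d_E(p) v`. Rank-nullity then gives `rank A(p) = rank
d_E(p) - rank d_G(p)`. For a bundle the presentation splits in the stalks, so these ranks are `rk E⁰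
- r` and `rk G⁰ - s` (`rank_eval_add`), and the corank of `A(p)` is `r - s`.

The sheaf statement is left exactness of `M ↦ M~`, checked on sections (`exists_mapSections_ker`).
-/

noncomputable section

/-! ### Homogeneous components in graded modules -/

namespace ModuleGrading

variable {A σ : Type*} [CommRing A] [SetLike σ A] [AddSubgroupClass σ A] {𝒜 : ℕ → σ}
  {M N : Type*} [AddCommGroup M] [Module A M] [AddCommGroup N] [Module A N]

open Classical in
/-- The homogeneous component of degree `j`. -/
def comp (ℳ : ModuleGrading 𝒜 M) (j : ℤ) : M →+ M :=
  letI := ℳ.isInternal.chooseDecomposition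
  { toFun := fun x => (DirectSum.decompose ℳ.piece x j : M)
    map_zero' := by simp
    map_add' := fun x y => by simp }

variable (ℳ : ModuleGrading 𝒜 M) (𝒩 : ModuleGrading 𝒜 N)

theorem comp_mem (j : ℤ) (x : M) : ℳ.comp j x ∈ ℳ.piece j := by
  classical
  let := ℳ.isInternal.chooseDecomposition
  exact (DirectSum.decompose ℳ.piece x j).2

variable {ℳ} in
theorem comp_of_mem {j : ℤ} {x : M} (hx : x ∈ ℳ.piece j) : ℳ.comp j x = x := by
  classical
  let := ℳ.isInternal.chooseDecomposition
  exact DirectSum.decompose_of_mem_same ℳ.piece hx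

variable {ℳ} in
theorem comp_of_mem_ne {i j : ℤ} {x : M} (hx : x ∈ ℳ.piece i) (h : i ≠ j) : ℳ.comp j x = 0 := by
  classical
  let := ℳ.isInternal.chooseDecomposition
  exact DirectSum.decompose_of_mem_ne ℳ.piece hx h

theorem induction {motive : M → Prop} (zero : motive 0)
    (homogeneous : ∀ j, ∀ x ∈ ℳ.piece j, motive x)
    (add : ∀ x y, motive x → motive y → motive (x + y)) (x : M) : motive x := by
  classical
  let := ℳ.isInternal.chooseDecomposition
  exact DirectSum.Decomposition.inductionOn ℳ.piece zero (fun y => homogeneous _ y.1 y.2) add x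

theorem comp_smul {i : ℕ} {a : A} (ha : a ∈ 𝒜 i) (j : ℤ) (x : M) :
    ℳ.comp (i + j) (a • x) = a • ℳ.comp j x := by
  induction x using ℳ.induction with
  | zero => simp
  | homogeneous l x hx =>
    by_cases h : l = j
    · subst h
      rw [comp_of_mem hx, comp_of_mem (ℳ.smul_mem ha hx)]
    · rw [comp_of_mem_ne hx h, comp_of_mem_ne (ℳ.smul_mem ha hx) (by omega), smul_zero]
  | add x y hx hy => simp [smul_add, hx, hy]

-- The tool that makes lifts homogeneous: if `f x` is homogeneous of degree `j`, the component of
-- `x` in degree `j` has the same image.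
variable {ℳ 𝒩} in
theorem IsGradedHom.map_comp {f : M →ₗ[A] N} (hf : ℳ.IsGradedHom 𝒩 f) (j : ℤ) (x : M) :
    f (ℳ.comp j x) = 𝒩.comp j (f x) := by
  induction x using ℳ.induction with
  | zero => simp
  | homogeneous l x hx =>
    by_cases h : l = j
    · subst h
      rw [comp_of_mem hx, comp_of_mem (hf _ _ hx)]
    · rw [comp_of_mem_ne hx h, comp_of_mem_ne (hf _ _ hx) h, map_zero]
  | add x y hx hy => simp [hx, hy]

/-- The maps `π j` read off the coordinates of a direct sum, which gives injectivity without a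
separate independence argument. For free modules they are given by coordinatewise homogeneous
components. -/
theorem isInternal_of_projections {piece : ℤ → AddSubgroup M} (π : ℤ → M →+ M)
    (same : ∀ j, ∀ x ∈ piece j, π j x = x) (ne : ∀ i j, i ≠ j → ∀ x ∈ piece i, π j x = 0)
    (gen : ∀ x, x ∈ ⨆ j, piece j) : DirectSum.IsInternal piece := by
  classical
  constructor
  · rw [injective_iff_map_eq_zero]
    intro y hy
    have key : ∀ (j : ℤ) (y : DirectSum ℤ fun j => piece j),
        π j (DirectSum.coeAddMonoidHom piece y) = y j := by
      intro j y
      induction y using DirectSum.induction_on with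
      | zero => simp
      | of i x =>
        rw [DirectSum.coeAddMonoidHom_of]
        by_cases h : i = j
        · subst h
          rw [same _ _ x.2, DirectSum.of_eq_same]
        · rw [ne _ _ h _ x.2, DirectSum.of_eq_of_ne _ _ _ (Ne.symm h)]
          rfl
      | add a b ha hb => simp [ha, hb]
    ext j
    rw [← key, hy, map_zero]
    rfl
  · intro x
    have h : (⨆ j, piece j) ≤ (DirectSum.coeAddMonoidHom piece).range :=
      iSup_le fun j x hx => ⟨DirectSum.of (fun j => piece j) j ⟨x, hx⟩,
        DirectSum.coeAddMonoidHom_of _ _ _⟩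
    exact h (gen x)

end ModuleGrading

/-! ### Polynomials in integer degrees, graded free modules, existence of minimal presentations. -/

section HomogeneousComponents

variable {k : Type u} [Field k] {n : ℕ}

theorem isHomogeneousOfDegree_zero (e : ℤ) : IsHomogeneousOfDegree (0 : PolyRing k n) e :=
  Or.inl rfl

theorem isHomogeneousOfDegree_natCast {p : PolyRing k n} {d : ℕ} :
    IsHomogeneousOfDegree p d ↔ p.IsHomogeneous d := by
  constructor
  · rintro (rfl | ⟨e, he, h⟩)
    · exact MvPolynomial.isHomogeneous_zero _ _ _
    · rwa [Nat.cast_inj.1 he] at h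
  · exact fun h => Or.inr ⟨d, rfl, h⟩

theorem IsHomogeneousOfDegree.eq_zero {p : PolyRing k n} {e : ℤ} (h : IsHomogeneousOfDegree p e)
    (he : e < 0) : p = 0 := by
  rcases h with rfl | ⟨d, hd, -⟩
  · rfl
  · omega

/-- Zero is homogeneous of every degree; splitting on the sign of `e` confines the special case `p =
0` to negative degrees. -/
theorem isHomogeneousOfDegree_cases {p : PolyRing k n} {e : ℤ} (h : IsHomogeneousOfDegree p e) :
    (e < 0 ∧ p = 0) ∨ ∃ d : ℕ, (d : ℤ) = e ∧ p.IsHomogeneous d := by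
  rcases lt_or_ge e 0 with he | he
  · exact Or.inl ⟨he, h.eq_zero he⟩
  · lift e to ℕ using he
    exact Or.inr ⟨e, rfl, isHomogeneousOfDegree_natCast.1 h⟩

theorem IsHomogeneousOfDegree.add {p q : PolyRing k n} {e : ℤ} (hp : IsHomogeneousOfDegree p e)
    (hq : IsHomogeneousOfDegree q e) : IsHomogeneousOfDegree (p + q) e := by
  rcases isHomogeneousOfDegree_cases hp with ⟨-, rfl⟩ | ⟨d, rfl, hd⟩
  · rwa [zero_add]
  · exact isHomogeneousOfDegree_natCast.2 (hd.add (isHomogeneousOfDegree_natCast.1 hq))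

theorem IsHomogeneousOfDegree.neg {p : PolyRing k n} {e : ℤ} (hp : IsHomogeneousOfDegree p e) :
    IsHomogeneousOfDegree (-p) e := by
  rcases isHomogeneousOfDegree_cases hp with ⟨-, rfl⟩ | ⟨d, rfl, hd⟩
  · rw [neg_zero]; exact isHomogeneousOfDegree_zero _
  · exact isHomogeneousOfDegree_natCast.2 hd.neg

theorem IsHomogeneousOfDegree.mul {p q : PolyRing k n} {e f : ℤ} (hp : IsHomogeneousOfDegree p e)
    (hq : IsHomogeneousOfDegree q f) : IsHomogeneousOfDegree (p * q) (e + f) := by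
  rcases hp with rfl | ⟨d, rfl, hd⟩
  · rw [zero_mul]; exact isHomogeneousOfDegree_zero _
  rcases hq with rfl | ⟨d', rfl, hd'⟩
  · rw [mul_zero]; exact isHomogeneousOfDegree_zero _
  · exact Or.inr ⟨d + d', by push_cast; rfl, hd.mul hd'⟩

theorem IsHomogeneousOfDegree.constantCoeff_eq_zero {p : PolyRing k n} {e : ℤ}
    (hp : IsHomogeneousOfDegree p e) (he : e ≠ 0) : MvPolynomial.constantCoeff p = 0 := by
  rcases hp with rfl | ⟨d, rfl, hd⟩
  · simp
  · rw [MvPolynomial.constantCoeff_eq]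
    refine hd.coeff_eq_zero ?_
    simpa using fun h => he (by simp [← h])

/-- The homogeneous component of integral degree `e` of a polynomial. -/
def homogeneousComponentInt (e : ℤ) : PolyRing k n →+ PolyRing k n :=
  if 0 ≤ e then (MvPolynomial.homogeneousComponent e.toNat).toAddMonoidHom else 0

theorem homogeneousComponentInt_of_mem {p : PolyRing k n} {e : ℤ}
    (hp : IsHomogeneousOfDegree p e) : homogeneousComponentInt e p = p := by
  rcases isHomogeneousOfDegree_cases hp with ⟨-, rfl⟩ | ⟨d, rfl, hd⟩
  · simp
  · simpa [homogeneousComponentInt] using MvPolynomial.homogeneousComponent_of_mem (m := d) hd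

theorem homogeneousComponentInt_of_mem_ne {p : PolyRing k n} {e f : ℤ}
    (hp : IsHomogeneousOfDegree p e) (h : e ≠ f) : homogeneousComponentInt f p = 0 := by
  rcases isHomogeneousOfDegree_cases hp with ⟨-, rfl⟩ | ⟨d, rfl, hd⟩
  · simp
  · unfold homogeneousComponentInt
    split_ifs with hf
    · lift f to ℕ using hf
      have := MvPolynomial.homogeneousComponent_of_mem (m := f) hd
      rw [if_neg (by omega)] at this
      simpa using this
    · rfl

theorem isHomogeneousOfDegree_smul_mem {M : Type u} [AddCommGroup M] [Module (PolyRing k n) M]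
    (ℳ : ModuleGrading (stdGrading k n) M) {p : PolyRing k n} {x : M} {e j i : ℤ}
    (hp : IsHomogeneousOfDegree p e) (hx : x ∈ ℳ.piece j) (h : e + j = i) : p • x ∈ ℳ.piece i := by
  rcases hp with rfl | ⟨d, rfl, hd⟩
  · rw [zero_smul]; exact zero_mem _
  · exact h ▸ ℳ.smul_mem hd hx

/-- The graded free module `⨁ₗ R(-deg l)`. -/
def freeGrading {r : ℕ} (deg : Fin r → ℤ) :
    ModuleGrading (stdGrading k n) (Fin r → PolyRing k n) where
  piece j :=
    { carrier := {v | ∀ l, IsHomogeneousOfDegree (v l) (j - deg l)}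
      zero_mem' := fun _ => isHomogeneousOfDegree_zero _
      add_mem' := fun ha hb l => (ha l).add (hb l)
      neg_mem' := fun ha l => (ha l).neg }
  smul_mem {i j a x} ha hx l := by
    have h := (isHomogeneousOfDegree_natCast.2 ha).mul (hx l)
    rwa [← add_sub_assoc] at h
  isInternal := by
    refine ModuleGrading.isInternal_of_projections
      (fun j => AddMonoidHom.mk' (fun v l => homogeneousComponentInt (j - deg l) (v l))
        fun a b => by ext1 l; simp) ?_ ?_ ?_
    · intro j x hx
      ext1 l
      exact homogeneousComponentInt_of_mem (hx l)
    · intro i j h x hx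
      ext1 l
      exact homogeneousComponentInt_of_mem_ne (hx l) (by omega)
    · intro v
      rw [← Finset.univ_sum_single v]
      refine sum_mem fun l _ => ?_
      rw [← MvPolynomial.sum_homogeneousComponent (v l), ← AddMonoidHom.single_apply, map_sum]
      refine sum_mem fun i _ => AddSubgroup.mem_iSup_of_mem (i + deg l) fun l' => ?_
      by_cases h : l' = l
      · subst h
        simpa using isHomogeneousOfDegree_natCast.2
          (MvPolynomial.homogeneousComponent_isHomogeneous i (v l'))
      · simpa [h] using isHomogeneousOfDegree_zero _

theorem mem_freeGrading {r : ℕ} {deg : Fin r → ℤ} {j : ℤ} {v : Fin r → PolyRing k n} :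
    v ∈ (freeGrading deg).piece j ↔ ∀ l, IsHomogeneousOfDegree (v l) (j - deg l) := Iff.rfl

theorem freeGrading_comp_apply {r : ℕ} (deg : Fin r → ℤ) (j : ℤ) (v : Fin r → PolyRing k n)
    (l : Fin r) : (freeGrading deg).comp j v l = homogeneousComponentInt (j - deg l) (v l) := by
  induction v using (freeGrading deg).induction with
  | zero => simp
  | homogeneous i x hx =>
    by_cases h : i = j
    · subst h
      rw [ModuleGrading.comp_of_mem hx, homogeneousComponentInt_of_mem (hx l)]
    · rw [ModuleGrading.comp_of_mem_ne hx h,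
        homogeneousComponentInt_of_mem_ne (hx l) (by omega)]
      rfl
  | add x y hx hy => simp [hx, hy]

theorem isGradedHom_linearCombination {M : Type u} [AddCommGroup M] [Module (PolyRing k n) M]
    (ℳ : ModuleGrading (stdGrading k n) M) {r : ℕ} {deg : Fin r → ℤ} {gen : Fin r → M}
    (h : ∀ l, gen l ∈ ℳ.piece (deg l)) :
    (freeGrading deg).IsGradedHom ℳ (Fintype.linearCombination (PolyRing k n) gen) := by
  intro j v hv
  rw [Fintype.linearCombination_apply]
  exact sum_mem fun l _ => isHomogeneousOfDegree_smul_mem ℳ (hv l) (h l) (by ring)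

theorem isGradedHom_mulVecLin {r r' : ℕ} {deg : Fin r → ℤ} {deg' : Fin r' → ℤ}
    {D : Matrix (Fin r) (Fin r') (PolyRing k n)}
    (h : ∀ l j, IsHomogeneousOfDegree (D l j) (deg' j - deg l)) :
    (freeGrading deg').IsGradedHom (freeGrading deg) D.mulVecLin := by
  intro j v hv l
  rw [Matrix.mulVecLin_apply, Matrix.mulVec, dotProduct]
  refine Finset.sum_induction _ (fun p => IsHomogeneousOfDegree p (j - deg l))
    (fun _ _ => IsHomogeneousOfDegree.add) (isHomogeneousOfDegree_zero _) fun i _ => ?_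
  have := (h l i).mul (hv i)
  rwa [show deg' i - deg l + (j - deg' i) = j - deg l by ring] at this

/-- A finitely generated graded module has a minimal system of homogeneous generators. -/
theorem exists_minimal_generators {M : Type u} [AddCommGroup M] [Module (PolyRing k n) M]
    [Module.Finite (PolyRing k n) M] (ℳ : ModuleGrading (stdGrading k n) M) :
    ∃ (r : ℕ) (deg : Fin r → ℤ) (gen : Fin r → M), (∀ l, gen l ∈ ℳ.piece (deg l)) ∧
      Function.Surjective (Fintype.linearCombination (PolyRing k n) gen) ∧
      ∀ v ∈ LinearMap.ker (Fintype.linearCombination (PolyRing k n) gen), ∀ l,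
        MvPolynomial.constantCoeff (v l) = 0 := by
  classical
  have hspan : Submodule.span (PolyRing k n) {x | ∃ j, x ∈ ℳ.piece j} = ⊤ := by
    rw [eq_top_iff]
    rintro x -
    induction x using ℳ.induction with
    | zero => exact zero_mem _
    | homogeneous j x hx => exact Submodule.subset_span ⟨j, hx⟩
    | add x y hx hy => exact add_mem hx hy
  have hex : ∃ c, ∃ s : Finset M, s.card = c ∧ (∀ x ∈ s, ∃ j, x ∈ ℳ.piece j) ∧
      Submodule.span (PolyRing k n) (s : Set M) = ⊤ := by
    have hfg := Module.Finite.fg_top (R := PolyRing k n) (M := M)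
    rw [← hspan, Submodule.fg_span_iff_fg_span_finset_subset] at hfg
    obtain ⟨s, hs, hs'⟩ := hfg
    exact ⟨_, s, rfl, fun x hx => hs hx, by rw [← hs', hspan]⟩
  -- Minimality is obtained from a homogeneous generating set with the fewest elements.
  obtain ⟨s, hcard, hs, hs'⟩ := Nat.find_spec hex
  choose deg hdeg using fun l : Fin s.card => hs _ (s.equivFin.symm l).2
  refine ⟨s.card, deg, fun l => (s.equivFin.symm l : M), hdeg, ?_, ?_⟩
  · rw [← LinearMap.range_eq_top, Fintype.range_linearCombination, ← hs']
    congr 1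
    ext x
    constructor
    · rintro ⟨l, rfl⟩
      exact (s.equivFin.symm l).2
    · intro hx
      exact ⟨s.equivFin ⟨x, hx⟩, by simp⟩
  · intro v hv l
    -- The component in degree `deg l` of such a relation has a nonzero scalar as its coefficient at
    -- `l`. The generator at `l` is then a combination of the others, against the choice of `s`.
    by_contra hc
    have hv' := (isGradedHom_linearCombination ℳ hdeg).map_comp (deg l) v
    rw [LinearMap.mem_ker.1 hv, map_zero, Fintype.linearCombination_apply,
      ← Finset.add_sum_erase _ _ (Finset.mem_univ l), freeGrading_comp_apply, sub_self] at hv'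
    have hcl : homogeneousComponentInt (0 : ℤ) (v l) =
        MvPolynomial.C (MvPolynomial.constantCoeff (v l)) := by
      simp [homogeneousComponentInt, MvPolynomial.homogeneousComponent_zero,
        MvPolynomial.constantCoeff_eq]
    rw [hcl] at hv'
    set x : M := (s.equivFin.symm l : M) with hx
    have hmem : x ∈ Submodule.span (PolyRing k n) ((s.erase x : Finset M) : Set M) := by
      have h1 : x = (MvPolynomial.C (MvPolynomial.constantCoeff (v l))⁻¹ : PolyRing k n) •
          ((MvPolynomial.C (MvPolynomial.constantCoeff (v l)) : PolyRing k n) • x) := by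
        rw [smul_smul, ← map_mul, inv_mul_cancel₀ hc, map_one, one_smul]
      refine (congrArg (· ∈ Submodule.span (PolyRing k n) ((s.erase x : Finset M) : Set M))
        h1).mpr ?_
      rw [eq_neg_of_add_eq_zero_left hv']
      refine Submodule.smul_mem _ _ (neg_mem (sum_mem fun l' hl' => Submodule.smul_mem _ _
        (Submodule.subset_span ?_)))
      rw [Finset.mem_coe, Finset.mem_erase]
      refine ⟨fun h => (Finset.ne_of_mem_erase hl') ?_, (s.equivFin.symm l').2⟩
      exact s.equivFin.symm.injective (Subtype.ext h)
    refine Nat.find_min hex (m := (s.erase x).card) ?_ ⟨s.erase x, rfl,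
      fun y hy => hs y (Finset.mem_of_mem_erase hy), ?_⟩
    · rw [← hcard]
      exact Finset.card_erase_lt_of_mem (s.equivFin.symm l).2
    · rw [eq_top_iff, ← hs', Submodule.span_le]
      intro y hy
      by_cases h : y = x
      · exact h ▸ hmem
      · exact Submodule.subset_span (Finset.mem_coe.2 (Finset.mem_erase.2 ⟨h, hy⟩))

/-- A finitely generated graded module has a minimal graded free presentation. -/
theorem nonempty_minimalPresentation {M : Type u} [AddCommGroup M] [Module (PolyRing k n) M]
    [Module.Finite (PolyRing k n) M] (ℳ : ModuleGrading (stdGrading k n) M) :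
    Nonempty (MinimalPresentation ℳ) := by
  obtain ⟨r, deg, gen, hgen, hsurj, hmin⟩ := exists_minimal_generators ℳ
  have hφ := isGradedHom_linearCombination ℳ hgen
  -- The relation module is finitely generated since `R` is Noetherian. Minimality of the generators
  -- yields `mat_minimal`, minimality of the relations yields `syz_minimal`.
  obtain ⟨r', deg', gen', hgen', hsurj', hmin'⟩ :=
    exists_minimal_generators ((freeGrading deg).ker ℳ _ hφ)
  have key : ∀ v, (Matrix.of fun l j => (gen' j).1 l).mulVecLin v =
      (Fintype.linearCombination (PolyRing k n) gen' v).1 := by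
    intro v
    ext1 l
    simp [Matrix.mulVec, dotProduct, Fintype.linearCombination_apply, mul_comm]
  exact ⟨{
    rk0 := r
    rk1 := r'
    deg0 := deg
    deg1 := deg'
    gen := gen
    mat := Matrix.of fun l j => (gen' j).1 l
    gen_mem := hgen
    mat_homogeneous := fun l j => hgen' j l
    surjective := hsurj
    exact := by
      apply le_antisymm
      · rintro _ ⟨v, rfl⟩
        rw [key]
        exact (Fintype.linearCombination (PolyRing k n) gen' v).2
      · intro w hw
        obtain ⟨v, hv⟩ := hsurj' ⟨w, hw⟩
        exact ⟨v, by rw [key, hv]⟩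
    mat_minimal := fun l j => hmin _ (gen' j).2 l
    syz_minimal := fun v hv => hmin' v <| by
      rw [LinearMap.mem_ker] at hv ⊢
      exact Subtype.ext ((key v).symm.trans hv) }⟩

end HomogeneousComponents

/-! ### The functor `M ↦ M~` is left exact -/

namespace ProjTilde

variable {A σ : Type u} [CommRing A] [SetLike σ A] [AddSubgroupClass σ A] {𝒜 : ℕ → σ}
  [GradedRing 𝒜] {M N : Type u} [AddCommGroup M] [Module A M] [AddCommGroup N] [Module A N]

/-- As `m` is homogeneous, the graded parts of `u • m` come from those of `u` one by one; so each
homogeneous part of an annihilator of `m` annihilates `m`. -/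
theorem comp_smul_of_mem (ℳ : ModuleGrading 𝒜 M) (i : ℕ) {d : ℤ} (u : A) {m : M}
    (hm : m ∈ ℳ.piece d) :
    ℳ.comp (i + d) (u • m) = (DirectSum.decompose 𝒜 u i : A) • m := by
  induction u using DirectSum.Decomposition.inductionOn 𝒜 with
  | zero => simp
  | @homogeneous j a =>
    by_cases h : j = i
    · subst h
      rw [ModuleGrading.comp_of_mem (ℳ.smul_mem a.2 hm), DirectSum.decompose_of_mem_same 𝒜 a.2]
    · rw [ModuleGrading.comp_of_mem_ne (ℳ.smul_mem a.2 hm) (by omega),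
        DirectSum.decompose_of_mem_ne 𝒜 a.2 h, zero_smul]
  | add a b ha hb => simp [add_smul, ha, hb]

theorem exists_decompose_notMem (x : ProjectiveSpectrum 𝒜) {u : A}
    (hu : u ∉ x.asHomogeneousIdeal.toIdeal) :
    ∃ i, (DirectSum.decompose 𝒜 u i : A) ∉ x.asHomogeneousIdeal.toIdeal := by
  classical
  by_contra! h
  refine hu ?_
  rw [← DirectSum.sum_support_decompose 𝒜 u]
  exact sum_mem fun i _ => h i

/-- If an element outside of a homogeneous prime annihilates a homogeneous element, so does a
homogeneous one. -/
theorem exists_homogeneous_smul_eq_zero (ℳ : ModuleGrading 𝒜 M) (x : ProjectiveSpectrum 𝒜)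
    {d : ℤ} {m : M} (hm : m ∈ ℳ.piece d) {u : A} (hu : u ∉ x.asHomogeneousIdeal.toIdeal)
    (h : u • m = 0) :
    ∃ (i : ℕ) (v : A), v ∈ 𝒜 i ∧ v ∉ x.asHomogeneousIdeal.toIdeal ∧ v • m = 0 := by
  obtain ⟨i, hi⟩ := exists_decompose_notMem x hu
  refine ⟨i, _, (DirectSum.decompose 𝒜 u i).2, hi, ?_⟩
  rw [← comp_smul_of_mem ℳ i u hm, h, map_zero]

theorem IsFracAt.eq_zero_iff {x : ProjectiveSpectrum 𝒜} {m : M} {s : A} {f : LocAt 𝒜 M x}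
    (hf : IsFracAt m s f) :
    f = 0 ↔ ∃ u : A, u ∉ x.asHomogeneousIdeal.toIdeal ∧ u • m = 0 := by
  obtain ⟨hs, rfl⟩ := hf
  rw [← LocalizedModule.zero_mk (1 : x.asHomogeneousIdeal.toIdeal.primeCompl),
    LocalizedModule.mk_eq]
  constructor
  · rintro ⟨u, hu⟩
    exact ⟨u.1, u.2, by simpa [Submonoid.smul_def] using hu⟩
  · rintro ⟨u, hu, h⟩
    exact ⟨⟨u, hu⟩, by simpa [Submonoid.smul_def] using h⟩

theorem mapAt_injective (x : ProjectiveSpectrum 𝒜) {φ : M →ₗ[A] N} (hφ : Function.Injective φ) :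
    Function.Injective (mapAt x φ) :=
  LocalizedModule.map_injective _ φ hφ

theorem mapSections_injective {ℳ : ModuleGrading 𝒜 M} {𝒩 : ModuleGrading 𝒜 N} {φ : M →ₗ[A] N}
    (hφ : ℳ.IsGradedHom 𝒩 φ) (hinj : Function.Injective φ)
    (U : (Opens (ProjectiveSpectrum.top 𝒜))ᵒᵖ) : Function.Injective (mapSections φ hφ U) := by
  intro f g h
  refine Subtype.ext (funext fun x => mapAt_injective x.1 hinj ?_)
  exact congrFun (congrArg Subtype.val h) x

/-- The open set where a homogeneous element does not vanish. -/
abbrev nonvanishing (v : A) : Opens (ProjectiveSpectrum.top 𝒜) := ProjectiveSpectrum.basicOpen 𝒜 v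

/-- If `m / s` dies in the localization of `N`, a homogeneous `v` outside the prime kills `φ m`.
Where `v` does not vanish, `m / s = (v m) / (v s)`, and this numerator lies in `ker φ`. The local
fractions agree on overlaps because localization keeps `ker φ → M` injective. -/
theorem exists_mapSections_ker {ℳ : ModuleGrading 𝒜 M} {𝒩 : ModuleGrading 𝒜 N} {φ : M →ₗ[A] N}
    (hφ : ℳ.IsGradedHom 𝒩 φ) (U : (Opens (ProjectiveSpectrum.top 𝒜))ᵒᵖ)
    (f : (sheafInType ℳ).1.obj U) (hf : mapSections φ hφ U f = 0) :
    ∃ g, mapSections (LinearMap.ker φ).subtype (ℳ.isGradedHom_ker_subtype 𝒩 φ hφ) U g = f := by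
  have loc : ∀ x : U.unop, ∃ (V : Opens (ProjectiveSpectrum.top 𝒜)) (_ : x.1 ∈ V)
      (_ : V ≤ U.unop) (d : ℕ) (m : LinearMap.ker φ) (s : A), m.1 ∈ ℳ.piece d ∧ s ∈ 𝒜 d ∧
      ∀ (y : ProjectiveSpectrum 𝒜) (hy : y ∈ U.unop), y ∈ V → IsFracAt m.1 s (f.1 ⟨y, hy⟩) := by
    intro x
    obtain ⟨V, hx, i, d, m, s, hm, hs, w⟩ := f.2 x
    have hx0 : mapAt x.1 φ (f.1 x) = 0 := congrFun (congrArg Subtype.val hf) x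
    obtain ⟨u, hu, hum⟩ := ((w ⟨x.1, hx⟩).map φ).eq_zero_iff.1 hx0
    obtain ⟨e, v, hv, hvx, hvm⟩ := exists_homogeneous_smul_eq_zero 𝒩 x.1 (hφ _ _ hm) hu hum
    refine ⟨V ⊓ nonvanishing v, ⟨hx, hvx⟩, fun y hy => i.le hy.1, e + d,
      ⟨v • m, by simp [hvm]⟩, v * s, ?_, SetLike.GradedMul.mul_mem hv hs, fun y hyU hy => ?_⟩
    · have := ℳ.smul_mem hv hm
      rwa [← Nat.cast_add] at this
    · obtain ⟨hsy, e⟩ := w ⟨y, hy.1⟩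
      refine ⟨mul_mem hy.2 hsy, (show f.1 ⟨y, hyU⟩ = _ from e).trans ?_⟩
      exact (LocalizedModule.mk_cancel_common_left ⟨v, hy.2⟩ ⟨s, hsy⟩ m).symm
  choose V hxV hVU d m s hm hs w using loc
  have frac : ∀ x (y : ProjectiveSpectrum 𝒜) (hy : y ∈ U.unop), y ∈ V x →
      ∀ h : s x ∈ y.asHomogeneousIdeal.toIdeal.primeCompl,
      mapAt y (LinearMap.ker φ).subtype (LocalizedModule.mk (m x) ⟨s x, h⟩) = f.1 ⟨y, hy⟩ := by
    intro x y hyU hy h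
    obtain ⟨h', e⟩ := w x y hyU hy
    rw [e]
    exact LocalizedModule.map_mk ..
  -- The value at each point uses the fraction chosen for that point; injectivity of `mapAt` shows
  -- that nearby it equals the single fraction chosen at `x`.
  refine ⟨⟨fun x => LocalizedModule.mk (m x) ⟨s x, (w x x.1 x.2 (hxV x)).1⟩, fun x => ?_⟩, ?_⟩
  · refine ⟨V x, hxV x, homOfLE (hVU x), d x, m x, s x, hm x, hs x, fun y => ?_⟩
    have hyU := hVU x y.2
    have hy := (w x y.1 hyU y.2).1
    refine ⟨hy, mapAt_injective y.1 (LinearMap.ker φ).injective_subtype ?_⟩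
    exact (frac ⟨y.1, hyU⟩ y.1 hyU (hxV _) _).trans (frac x y.1 hyU y.2 hy).symm
  · exact Subtype.ext (funext fun x => frac x x.1 x.2 (hxV x) _)

theorem tildeMap_ker_comp {ℳ : ModuleGrading 𝒜 M} {𝒩 : ModuleGrading 𝒜 N} {φ : M →ₗ[A] N}
    (hφ : ℳ.IsGradedHom 𝒩 φ) :
    tildeMap (ℳ.ker 𝒩 φ hφ) ℳ (LinearMap.ker φ).subtype (ℳ.isGradedHom_ker_subtype 𝒩 φ hφ) ≫
      tildeMap ℳ 𝒩 φ hφ = 0 := by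
  refine Scheme.Modules.hom_ext _ _ fun U => ?_
  ext f
  refine Subtype.ext (funext fun x => ?_)
  obtain ⟨V, hx, i, d, m, s, hm, hs, w⟩ := (show (sheafInType (ℳ.ker 𝒩 φ hφ)).1.obj (op U)
    from f).2 x
  refine (((w ⟨x.1, hx⟩).map (LinearMap.ker φ).subtype).map φ).eq_zero_iff.2 ⟨1, ?_, ?_⟩
  · exact (Ideal.ne_top_iff_one _).1 x.1.isPrime.ne_top
  · rw [one_smul]
    exact m.2

/-- The action of sections of the structure sheaf on sections of `M~`. -/
def sectionSMul (ℳ : ModuleGrading 𝒜 M) (U : (Opens (ProjectiveSpectrum.top 𝒜))ᵒᵖ)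
    (a : (ProjectiveSpectrum.Proj.structureSheaf 𝒜).1.obj U) (f : (sheafInType ℳ).1.obj U) :
    (sheafInType ℳ).1.obj U := a • f

theorem mapSections_sectionSMul {ℳ : ModuleGrading 𝒜 M} {𝒩 : ModuleGrading 𝒜 N} {φ : M →ₗ[A] N}
    (hφ : ℳ.IsGradedHom 𝒩 φ) (U : (Opens (ProjectiveSpectrum.top 𝒜))ᵒᵖ)
    (a : (ProjectiveSpectrum.Proj.structureSheaf 𝒜).1.obj U) (f : (sheafInType ℳ).1.obj U) :
    mapSections φ hφ U (sectionSMul ℳ U a f) = sectionSMul 𝒩 U a (mapSections φ hφ U f) :=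
  Subtype.ext <| funext fun x => mapAt_smulAt φ (a.1 x) (f.1 x)

/-- A morphism of sheaves of modules `T ⟶ M~` which is annihilated by `M~ ⟶ N~` factors
through `(ker φ)~`. -/
theorem exists_lift_ker {ℳ : ModuleGrading 𝒜 M} {𝒩 : ModuleGrading 𝒜 N} {φ : M →ₗ[A] N}
    (hφ : ℳ.IsGradedHom 𝒩 φ) {T : (Proj 𝒜).Modules} (t : T ⟶ tilde ℳ)
    (ht : t ≫ tildeMap ℳ 𝒩 φ hφ = 0) :
    ∃ l : T ⟶ tilde (ℳ.ker 𝒩 φ hφ), l ≫ tildeMap (ℳ.ker 𝒩 φ hφ) ℳ (LinearMap.ker φ).subtype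
      (ℳ.isGradedHom_ker_subtype 𝒩 φ hφ) = t := by
  let tU (U : (Opens (ProjectiveSpectrum.top 𝒜))ᵒᵖ) :
      T.val.presheaf.obj U →+ (sheafInType ℳ).1.obj U :=
    AddCommGrpCat.Hom.hom ((PresheafOfModules.toPresheaf _).map t.val |>.app U)
  have hex : ∀ U (a : T.val.presheaf.obj U), ∃ g,
      mapSections (LinearMap.ker φ).subtype (ℳ.isGradedHom_ker_subtype 𝒩 φ hφ) U g = tU U a := by
    intro U a
    refine exists_mapSections_ker hφ U _ ?_
    have := congrArg (fun ψ : T ⟶ tilde 𝒩 => ψ.app U.unop a) ht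
    exact this
  choose g hg using hex
  -- The lifts `g U a` are chosen arbitrarily; injectivity on sections forces them to be additive,
  -- natural and linear.
  have hinj := fun U => mapSections_injective (ℳ.isGradedHom_ker_subtype 𝒩 φ hφ)
    (LinearMap.ker φ).injective_subtype U
  let gU (U : (Opens (ProjectiveSpectrum.top 𝒜))ᵒᵖ) :
      T.val.presheaf.obj U →+ (sheafInType (ℳ.ker 𝒩 φ hφ)).1.obj U :=
    AddMonoidHom.mk' (g U) fun a b => hinj U <|
      ((hg U _).trans (map_add (tU U) a b)).trans <| Eq.trans
        (congrArg₂ (· + ·) (hg U a).symm (hg U b).symm) (map_add (mapSections _ _ U) _ _).symm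
  let l : T ⟶ tilde (ℳ.ker 𝒩 φ hφ) :=
    { val := PresheafOfModules.homMk (M₁ := T.val) (M₂ := presheafOfModules (ℳ.ker 𝒩 φ hφ))
        { app U := AddCommGrpCat.ofHom (gU U)
          naturality U V i := by
            ext a
            have e := NatTrans.naturality_apply ((PresheafOfModules.toPresheaf _).map t.val) i a
            exact hinj V <| (hg V _).trans <| e.trans
              (congrArg ((sheafInType ℳ).1.map i) (hg U a).symm) }
        fun U a b => by
          refine hinj U <| (hg U _).trans <| ((t.val.app U).hom.map_smul a b).trans ?_
          exact (congrArg (sectionSMul ℳ U a) (hg U b).symm).trans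
            (mapSections_sectionSMul (ℳ.isGradedHom_ker_subtype 𝒩 φ hφ) U a (g U b)).symm }
  refine ⟨l, Scheme.Modules.hom_ext _ _ fun U => ?_⟩
  ext a
  exact hg (op U) a

/-- `(ker φ)~` is the kernel of `M~ ⟶ N~`. -/
theorem exists_iso_kernel {ℳ : ModuleGrading 𝒜 M} {𝒩 : ModuleGrading 𝒜 N} {φ : M →ₗ[A] N}
    (hφ : ℳ.IsGradedHom 𝒩 φ) :
    ∃ e : tilde (ℳ.ker 𝒩 φ hφ) ≅ Limits.kernel (tildeMap ℳ 𝒩 φ hφ),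
      e.hom ≫ Limits.kernel.ι (tildeMap ℳ 𝒩 φ hφ) =
        tildeMap (ℳ.ker 𝒩 φ hφ) ℳ (LinearMap.ker φ).subtype
          (ℳ.isGradedHom_ker_subtype 𝒩 φ hφ) := by
  have hmono : Mono (tildeMap (ℳ.ker 𝒩 φ hφ) ℳ (LinearMap.ker φ).subtype
      (ℳ.isGradedHom_ker_subtype 𝒩 φ hφ)) := by
    refine ⟨fun {T} a b h => Scheme.Modules.hom_ext _ _ fun U => ?_⟩
    ext y
    exact mapSections_injective (ℳ.isGradedHom_ker_subtype 𝒩 φ hφ)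
      (LinearMap.ker φ).injective_subtype (op U)
      (congrArg (fun ψ : T ⟶ tilde ℳ => ψ.app U y) h)
  choose lift hlift using fun (T : (Proj 𝒜).Modules) (t : T ⟶ tilde ℳ) => exists_lift_ker hφ t
  have hlim : Limits.IsLimit (Limits.KernelFork.ofι _ (tildeMap_ker_comp hφ)) :=
    Limits.KernelFork.IsLimit.ofι' _ _ fun t ht => ⟨lift _ t ht, hlift _ t ht⟩
  refine ⟨Limits.IsLimit.conePointUniqueUpToIso hlim (Limits.limit.isLimit _), ?_⟩
  exact Limits.IsLimit.conePointUniqueUpToIso_hom_comp hlim _ Limits.WalkingParallelPair.zero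

end ProjTilde

/-! ### Stalks of vector bundles `M~` -/

namespace ProjTilde

variable {A σ : Type u} [CommRing A] [SetLike σ A] [AddSubgroupClass σ A] {𝒜 : ℕ → σ}
  [GradedRing 𝒜] {M N : Type u} [AddCommGroup M] [Module A M] [AddCommGroup N] [Module A N]

/-- The value of a section of `M~` at a point. -/
def valueAt (ℳ : ModuleGrading 𝒜 M) (V : (Proj 𝒜).Opens) (x : ProjectiveSpectrum 𝒜)
    (hx : x ∈ (show Opens (ProjectiveSpectrum.top 𝒜) from V)) :
    Γ(tilde ℳ, V) →+ LocAt 𝒜 M x where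
  toFun f := (show (sheafInType ℳ).1.obj (op V) from f).1 ⟨x, hx⟩
  map_zero' := rfl
  map_add' _ _ := rfl

/-- The value of a section of the structure sheaf at a point. -/
def ringValueAt (V : (Proj 𝒜).Opens) (x : ProjectiveSpectrum 𝒜)
    (hx : x ∈ (show Opens (ProjectiveSpectrum.top 𝒜) from V)) (c : Γ(Proj 𝒜, V)) : RingAt 𝒜 x :=
  (show (ProjectiveSpectrum.Proj.structureSheaf 𝒜).1.obj (op V) from c).1 ⟨x, hx⟩

theorem valueAt_smul (ℳ : ModuleGrading 𝒜 M) (V : (Proj 𝒜).Opens) (x : ProjectiveSpectrum 𝒜)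
    (hx : x ∈ (show Opens (ProjectiveSpectrum.top 𝒜) from V)) (c : Γ(Proj 𝒜, V))
    (f : Γ(tilde ℳ, V)) :
    valueAt ℳ V x hx (c • f) = smulAt (ringValueAt V x hx c) (valueAt ℳ V x hx f) := rfl

theorem valueAt_map (ℳ : ModuleGrading 𝒜 M) {U V : (Proj 𝒜).Opens} (h : V ≤ U)
    (x : ProjectiveSpectrum 𝒜)
    (hx : x ∈ (show Opens (ProjectiveSpectrum.top 𝒜) from V)) (f : Γ(tilde ℳ, U)) :
    valueAt ℳ V x hx ((tilde ℳ).presheaf.map (homOfLE h).op f) = valueAt ℳ U x (h hx) f := rfl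

theorem section_ext (ℳ : ModuleGrading 𝒜 M) (V : (Proj 𝒜).Opens) (f g : Γ(tilde ℳ, V))
    (h : ∀ x hx, valueAt ℳ V x hx f = valueAt ℳ V x hx g) : f = g :=
  Subtype.ext (funext fun x => h x.1 x.2)

theorem exists_isFracAt_near (ℳ : ModuleGrading 𝒜 M) (U : (Proj 𝒜).Opens) (f : Γ(tilde ℳ, U))
    (x : ProjectiveSpectrum 𝒜) (hx : x ∈ (show Opens (ProjectiveSpectrum.top 𝒜) from U)) :
    ∃ (V : Opens (ProjectiveSpectrum.top 𝒜)) (h : V ≤ U) (_ : x ∈ V) (d : ℕ) (m : M) (s : A),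
      m ∈ ℳ.piece d ∧ s ∈ 𝒜 d ∧
        ∀ (y : ProjectiveSpectrum 𝒜) (hy : y ∈ V), IsFracAt m s (valueAt ℳ U y (h hy) f) := by
  obtain ⟨V, hxV, i, d, m, s, hm, hs, w⟩ :=
    (show (sheafInType ℳ).1.obj (op U) from f).2 ⟨x, hx⟩
  exact ⟨V, i.le, hxV, d, m, s, hm, hs, fun y hy => w ⟨y, hy⟩⟩

theorem exists_section_of_fraction (ℳ : ModuleGrading 𝒜 M) (V : (Proj 𝒜).Opens) {d : ℕ} {m : M}
    {s : A} (hm : m ∈ ℳ.piece d) (hs : s ∈ 𝒜 d)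
    (hV : (show Opens (ProjectiveSpectrum.top 𝒜) from V) ≤ nonvanishing s) :
    ∃ f : Γ(tilde ℳ, V), ∀ x hx, IsFracAt m s (valueAt ℳ V x hx f) :=
  ⟨(show (sheafInType ℳ).1.obj (op V) from
    ⟨fun x => LocalizedModule.mk m ⟨s, hV x.2⟩,
      fun x => ⟨V, x.2, 𝟙 _, d, m, s, hm, hs, fun y => ⟨hV y.2, rfl⟩⟩⟩),
    fun _ hx => ⟨hV hx, rfl⟩⟩

theorem exists_ring_section_of_fraction (V : (Proj 𝒜).Opens) {d : ℕ} (a b : 𝒜 d)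
    (hV : (show Opens (ProjectiveSpectrum.top 𝒜) from V) ≤ nonvanishing (b : A)) :
    ∃ c : Γ(Proj 𝒜, V), ∀ x hx, ringValueAt V x hx c =
      HomogeneousLocalization.mk ⟨d, a, b, hV hx⟩ :=
  ⟨(show (ProjectiveSpectrum.Proj.structureSheaf 𝒜).1.obj (op V) from
    ⟨fun x => HomogeneousLocalization.mk ⟨d, a, b, hV x.2⟩,
      fun x => ⟨V, x.2, 𝟙 _, d, a, b, fun y => hV y.2, fun _ => rfl⟩⟩),
    fun _ _ => rfl⟩

/-- The stalk of a vector bundle `M~` is free over the local ring: it has a basis consisting of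
homogeneous fractions of degree zero. -/
theorem exists_stalk_basis (ℳ : ModuleGrading 𝒜 M) {r : ℕ}
    (h : IsVectorBundleOfRank (tilde ℳ) r) (x : ProjectiveSpectrum 𝒜) :
    ∃ σ : Fin r → LocAt 𝒜 M x,
      (∀ j, ∃ (d : ℕ) (m : M) (s : A), m ∈ ℳ.piece d ∧ s ∈ 𝒜 d ∧ IsFracAt m s (σ j)) ∧
      (∀ (d : ℕ) (m : M) (s : A), m ∈ ℳ.piece d → s ∈ 𝒜 d → ∀ f : LocAt 𝒜 M x,
        IsFracAt m s f → ∃ c : Fin r → RingAt 𝒜 x, f = ∑ j, smulAt (c j) (σ j)) ∧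
      ∀ c : Fin r → RingAt 𝒜 x, ∑ j, smulAt (c j) (σ j) = 0 → c = 0 := by
  classical
  obtain ⟨U, hxU, s, hs⟩ := h x
  refine ⟨fun j => valueAt ℳ U x hxU (s j), fun j => ?_, fun d m t hm ht f hf => ?_,
    fun c hc => ?_⟩
  · obtain ⟨V, hV, hxV, d, m, t, hm, ht, w⟩ := exists_isFracAt_near ℳ U (s j) x hxU
    exact ⟨d, m, t, hm, ht, w x hxV⟩
  -- Spanning: the fraction is a section over the part of `U` where `t` does not vanish, and the
  -- frame still spans there.
  · obtain ⟨ht', rfl⟩ := hf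
    let V : (Proj 𝒜).Opens := (show Opens (ProjectiveSpectrum.top 𝒜) from U) ⊓ nonvanishing t
    have hVU : V ≤ U := inf_le_left (a := (show Opens (ProjectiveSpectrum.top 𝒜) from U))
    obtain ⟨g, hg⟩ := exists_section_of_fraction ℳ V hm ht inf_le_right
    have hmem : g ∈ Submodule.span Γ(Proj 𝒜, V)
        (Set.range fun i => (tilde ℳ).presheaf.map (homOfLE hVU).op (s i)) := by
      rw [(hs V hVU).2]; trivial
    obtain ⟨c, hc⟩ := Submodule.mem_span_range_iff_exists_fun _ |>.1 hmem
    have hxV : x ∈ (show Opens (ProjectiveSpectrum.top 𝒜) from V) := ⟨hxU, ht'⟩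
    refine ⟨fun j => ringValueAt V x hxV (c j), ?_⟩
    obtain ⟨_, e⟩ := hg x hxV
    rw [← e, ← hc, map_sum]
    rfl
  -- Independence: the coefficients extend to sections `γ j` where the product of their denominators
  -- is nonzero. The combination `τ` vanishes at `x`, hence on a neighbourhood, where independence
  -- of the frame gives `γ j = 0`.
  · choose e he using fun j => HomogeneousLocalization.mk_surjective (c j)
    set b : A := ∏ j, ((e j).den : A) with hb
    have hxb : x ∈ nonvanishing (𝒜 := 𝒜) b := by
      change b ∉ x.asHomogeneousIdeal.toIdeal
      rw [hb, Ideal.IsPrime.prod_mem_iff]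
      rintro ⟨j, -, hj⟩
      exact (e j).den_mem hj
    have hle : ∀ j, nonvanishing (𝒜 := 𝒜) b ≤ nonvanishing ((e j).den : A) := by
      intro j y hy hj
      exact hy (Ideal.mem_of_dvd _ (Finset.dvd_prod_of_mem (fun j => ((e j).den : A))
        (Finset.mem_univ j)) hj)
    let V₀ : (Proj 𝒜).Opens := (show Opens (ProjectiveSpectrum.top 𝒜) from U) ⊓ nonvanishing b
    have hV₀U : V₀ ≤ U := inf_le_left (a := (show Opens (ProjectiveSpectrum.top 𝒜) from U))
    have hxV₀ : x ∈ (show Opens (ProjectiveSpectrum.top 𝒜) from V₀) := ⟨hxU, hxb⟩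
    choose γ hγ using fun j => exists_ring_section_of_fraction V₀ (e j).num (e j).den
      (le_trans inf_le_right (hle j))
    have hγx : ∀ j, ringValueAt V₀ x hxV₀ (γ j) = c j := fun j => (hγ j x hxV₀).trans (he j)
    let τ : Γ(tilde ℳ, V₀) := ∑ j, γ j • (tilde ℳ).presheaf.map (homOfLE hV₀U).op (s j)
    have hτx : valueAt ℳ V₀ x hxV₀ τ = 0 := by
      rw [← hc, map_sum]
      refine Finset.sum_congr rfl fun j _ => ?_
      rw [valueAt_smul, hγx, valueAt_map]
    obtain ⟨W, hW, hxW, d, m, t, hm, ht, w⟩ := exists_isFracAt_near ℳ V₀ τ x hxV₀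
    obtain ⟨u, hu, hum⟩ := (w x hxW).eq_zero_iff.1 hτx
    obtain ⟨i, v, hv, hvx, hvm⟩ := exists_homogeneous_smul_eq_zero ℳ x hm hu hum
    let V : (Proj 𝒜).Opens := W ⊓ nonvanishing v
    have hVW : (show Opens (ProjectiveSpectrum.top 𝒜) from V) ≤ W := inf_le_left
    have hVV₀ : V ≤ V₀ := hVW.trans hW
    have hxV : x ∈ (show Opens (ProjectiveSpectrum.top 𝒜) from V) := ⟨hxW, hvx⟩
    have hτV : (tilde ℳ).presheaf.map (homOfLE hVV₀).op τ = 0 := by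
      refine section_ext ℳ V _ _ fun y hy => ?_
      rw [valueAt_map, map_zero]
      exact (w y (hVW hy)).eq_zero_iff.2 ⟨v, hy.2, hvm⟩
    have hli := Fintype.linearIndependent_iff.1 (hs V (hVV₀.trans hV₀U)).1
      (fun j => (Proj 𝒜).presheaf.map (homOfLE hVV₀).op (γ j)) (by
        rw [← hτV, map_sum]
        refine Finset.sum_congr rfl fun j _ => ?_
        rw [Scheme.Modules.map_smul]
        rfl)
    funext j
    rw [← hγx]
    exact congrArg (ringValueAt V x hxV) (hli j)

end ProjTilde

/-! ### Presentations of free modules -/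

section FreePresentation

open Matrix

/-- A presentation `O^c --D--> O^e --> O^r --> 0` splits. -/
theorem exists_splitting_of_presentation {O N : Type*} [CommRing O] [AddCommGroup N] [Module O N]
    {r e c : ℕ} {σ : Fin r → N} {g : Fin e → N} {D : Matrix (Fin e) (Fin c) O}
    (hσ : ∀ v : Fin r → O, ∑ j, v j • σ j = 0 → v = 0)
    (hg : ∀ l, ∃ v : Fin r → O, g l = ∑ j, v j • σ j)
    (hσg : ∀ j, ∃ v : Fin e → O, σ j = ∑ l, v l • g l)
    (hD : ∀ i, ∑ l, D l i • g l = 0)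
    (hker : ∀ v : Fin e → O, ∑ l, v l • g l = 0 → ∃ w, v = D *ᵥ w) :
    ∃ (Φ : Matrix (Fin r) (Fin e) O) (S : Matrix (Fin e) (Fin r) O) (C : Matrix (Fin c) (Fin e) O),
      Φ * S = 1 ∧ Φ * D = 0 ∧ S * Φ + D * C = 1 := by
  choose Φ hΦ using hg
  choose S hS using hσg
  have hΦsum : ∀ v : Fin e → O, ∑ l, v l • g l = ∑ j, ((Matrix.of Φ)ᵀ *ᵥ v) j • σ j := by
    intro v
    simp_rw [hΦ, Finset.smul_sum, Matrix.mulVec, dotProduct, Finset.sum_smul, smul_smul]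
    rw [Finset.sum_comm]
    simp [mul_comm]
  have hSsum : ∀ v : Fin r → O, ∑ j, v j • σ j = ∑ l, ((Matrix.of S)ᵀ *ᵥ v) l • g l := by
    intro v
    simp_rw [hS, Finset.smul_sum, Matrix.mulVec, dotProduct, Finset.sum_smul, smul_smul]
    rw [Finset.sum_comm]
    simp [mul_comm]
  have key : ∀ v : Fin r → O, (Matrix.of Φ)ᵀ *ᵥ ((Matrix.of S)ᵀ *ᵥ v) = v := by
    intro v
    have := hσ ((Matrix.of Φ)ᵀ *ᵥ ((Matrix.of S)ᵀ *ᵥ v) - v) (by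
      simp_rw [Pi.sub_apply, sub_smul, Finset.sum_sub_distrib, ← hΦsum, ← hSsum, sub_self])
    exact sub_eq_zero.1 this
  -- `Φ` writes the generators in the basis and `S` the basis in the generators. Passing through
  -- both does not change the element of `N`, so `1 - S Φ` takes values in the relations.
  have hC : ∀ l, ∃ w, (1 - (Matrix.of S)ᵀ * (Matrix.of Φ)ᵀ) *ᵥ Pi.single l 1 = D *ᵥ w := by
    intro l
    refine hker _ ?_
    rw [hΦsum, Matrix.sub_mulVec, Matrix.one_mulVec, Matrix.mulVec_sub, ← Matrix.mulVec_mulVec,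
      key]
    simp
  choose C hC using hC
  refine ⟨(Matrix.of Φ)ᵀ, (Matrix.of S)ᵀ, (Matrix.of C)ᵀ, ?_, ?_, ?_⟩
  · refine Matrix.ext_of_mulVec_single fun j => ?_
    rw [← Matrix.mulVec_mulVec, key, Matrix.one_mulVec]
  · refine Matrix.ext_of_mulVec_single fun i => ?_
    rw [← Matrix.mulVec_mulVec, Matrix.zero_mulVec]
    refine hσ _ ?_
    rw [← hΦsum, ← hD i]
    simp
  · refine Matrix.ext_of_mulVec_single fun l => ?_
    rw [Matrix.add_mulVec, ← Matrix.mulVec_mulVec _ D, Matrix.one_mulVec]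
    have h : (Matrix.of C)ᵀ *ᵥ Pi.single l 1 = C l := by
      ext i
      simp
    rw [h, ← hC l, Matrix.sub_mulVec, Matrix.one_mulVec, add_sub_cancel]

/-- `C` is a generalized inverse of `D`, so `1 - C D` maps into the kernel of `D`; this is used to
correct a vector lying in the kernel only at one point. -/
theorem mul_mul_of_splitting {O : Type*} [CommRing O] {r e c : ℕ} {Φ : Matrix (Fin r) (Fin e) O}
    {S : Matrix (Fin e) (Fin r) O} {C : Matrix (Fin c) (Fin e) O} {D : Matrix (Fin e) (Fin c) O}
    (h₂ : Φ * D = 0) (h₃ : S * Φ + D * C = 1) : D * C * D = D := by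
  have h : (S * Φ + D * C) * D = (1 : Matrix (Fin e) (Fin e) O) * D := by rw [h₃]
  rwa [Matrix.add_mul, Matrix.one_mul, Matrix.mul_assoc S, h₂, Matrix.mul_zero, zero_add] at h

/-- Unlike bare exactness, the three identities survive every ring homomorphism, in particular
evaluation at a point; over a field they make `K^c → K^e → K^r → 0` exact. -/
theorem rank_add_of_splitting {K : Type*} [Field K] {r e c : ℕ} {Φ : Matrix (Fin r) (Fin e) K}
    {S : Matrix (Fin e) (Fin r) K} {C : Matrix (Fin c) (Fin e) K} {D : Matrix (Fin e) (Fin c) K}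
    (h₁ : Φ * S = 1) (h₂ : Φ * D = 0) (h₃ : S * Φ + D * C = 1) : D.rank + r = e := by
  have hker : LinearMap.range D.mulVecLin = LinearMap.ker Φ.mulVecLin := by
    ext v
    rw [LinearMap.mem_range, LinearMap.mem_ker, Matrix.mulVecLin_apply]
    constructor
    · rintro ⟨w, rfl⟩
      rw [Matrix.mulVecLin_apply, Matrix.mulVec_mulVec, h₂, Matrix.zero_mulVec]
    · intro hv
      refine ⟨C *ᵥ v, ?_⟩
      have := congrArg (fun X => X *ᵥ v) h₃
      simpa [Matrix.add_mulVec, ← Matrix.mulVec_mulVec, hv] using this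
  have hsurj : LinearMap.range Φ.mulVecLin = ⊤ := by
    rw [LinearMap.range_eq_top]
    intro v
    exact ⟨S *ᵥ v, by simp [Matrix.mulVec_mulVec, h₁]⟩
  have := LinearMap.finrank_range_add_finrank_ker Φ.mulVecLin
  rw [hsurj, finrank_top, ← hker] at this
  simp only [Module.finrank_fintype_fun_eq_card, Fintype.card_fin] at this
  rw [Matrix.rank]
  omega

end FreePresentation

/-! ### Closed points of projective space -/

section ClosedPoint

variable {k : Type u} [Field k] {n : ℕ}

/-- The point of `Proj k[x₀, …, xₙ]` with homogeneous coordinates `p`. -/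
def closedPoint (p : Fin (n + 1) → k) (hp : p ≠ 0) : ProjectiveSpectrum (stdGrading k n) where
  asHomogeneousIdeal := (RingHom.ker (MvPolynomial.eval p)).homogeneousCore (stdGrading k n)
  isPrime := (RingHom.ker_isPrime (MvPolynomial.eval p)).homogeneousCore
  not_irrelevant_le h := by
    obtain ⟨i, hi⟩ := Function.ne_iff.1 hp
    have h1 : (MvPolynomial.X i : PolyRing k n) ∈
        HomogeneousIdeal.irrelevant (stdGrading k n) :=
      HomogeneousIdeal.mem_irrelevant_of_mem _ one_pos (MvPolynomial.isHomogeneous_X k i)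
    have h2 := Ideal.toIdeal_homogeneousCore_le _ _ (h h1)
    exact hi (by simpa [RingHom.mem_ker] using h2)

/-- Passing to the homogeneous core does not change the homogeneous elements of the ideal of `p`. -/
theorem mem_closedPoint {p : Fin (n + 1) → k} {hp : p ≠ 0} {f : PolyRing k n} {d : ℕ}
    (hf : f ∈ stdGrading k n d) :
    f ∈ (closedPoint p hp).asHomogeneousIdeal.toIdeal ↔ MvPolynomial.eval p f = 0 :=
  ⟨fun h => Ideal.toIdeal_homogeneousCore_le _ _ h,
    fun h => Ideal.mem_homogeneousCore_of_homogeneous_of_mem ⟨d, hf⟩ h⟩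

theorem localization_mk_eq_mk {p : Fin (n + 1) → k} {hp : p ≠ 0} {a a' : PolyRing k n}
    {b b' : (closedPoint p hp).asHomogeneousIdeal.toIdeal.primeCompl}
    (h : Localization.mk a b = Localization.mk a' b') : a * b' = a' * b := by
  obtain ⟨c, hc⟩ := Localization.r_iff_exists.1 (Localization.mk_eq_mk_iff.1 h)
  have hc0 : (c : PolyRing k n) ≠ 0 := fun h0 => c.2 (h0 ▸ zero_mem _)
  have := mul_left_cancel₀ hc0 hc
  rw [mul_comm, this, mul_comm]

/-- Well-definedness of evaluation. The representative `a / b` need not be homogeneous, and an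
inhomogeneous `b` outside the homogeneous core may vanish at `p`; hence the separate hypothesis
`hb'`. -/
theorem eval_div_eval {p : Fin (n + 1) → k} {hp : p ≠ 0}
    {z : ProjTilde.RingAt (stdGrading k n) (closedPoint p hp)} {a b : PolyRing k n}
    (hb : b ∈ (closedPoint p hp).asHomogeneousIdeal.toIdeal.primeCompl)
    (hb' : MvPolynomial.eval p b ≠ 0) (h : z.val = Localization.mk a ⟨b, hb⟩) :
    MvPolynomial.eval p z.num / MvPolynomial.eval p z.den =
      MvPolynomial.eval p a / MvPolynomial.eval p b := by
  have hd : MvPolynomial.eval p z.den ≠ 0 := fun h0 =>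
    z.den_mem ((mem_closedPoint z.den_mem_deg).2 h0)
  rw [z.eq_num_div_den] at h
  have := congrArg (MvPolynomial.eval p) (localization_mk_eq_mk h)
  rw [div_eq_div_iff hd hb']
  simpa using this

/-- The evaluation of homogeneous fractions of degree zero at a closed point. -/
def evalAt (p : Fin (n + 1) → k) (hp : p ≠ 0) :
    ProjTilde.RingAt (stdGrading k n) (closedPoint p hp) →+* k :=
  have hd (z : ProjTilde.RingAt (stdGrading k n) (closedPoint p hp)) :
      MvPolynomial.eval p z.den ≠ 0 := fun h0 =>
    z.den_mem ((mem_closedPoint z.den_mem_deg).2 h0)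
  { toFun := fun z => MvPolynomial.eval p z.num / MvPolynomial.eval p z.den
    map_one' := by
      rw [eval_div_eval (a := 1) (b := 1) (one_mem _) (by simp) (by
        rw [HomogeneousLocalization.val_one]; exact Localization.mk_one.symm)]
      simp
    map_zero' := by
      rw [eval_div_eval (a := 0) (b := 1) (one_mem _) (by simp) (by
        rw [HomogeneousLocalization.val_zero]; exact (Localization.mk_zero _).symm)]
      simp
    map_mul' := fun z w => by
      rw [eval_div_eval (a := z.num * w.num) (b := z.den * w.den)
        (mul_mem z.den_mem w.den_mem) (by simp [hd]) (by
          rw [HomogeneousLocalization.val_mul, z.eq_num_div_den, w.eq_num_div_den]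
          exact Localization.mk_mul _ _ _ _)]
      simp [mul_div_mul_comm]
    map_add' := fun z w => by
      rw [eval_div_eval (a := z.den * w.num + w.den * z.num) (b := z.den * w.den)
        (mul_mem z.den_mem w.den_mem) (by simp [hd]) (by
          rw [HomogeneousLocalization.val_add, z.eq_num_div_den, w.eq_num_div_den]
          exact Localization.add_mk _ _ _ _)]
      have h1 := hd z
      have h2 := hd w
      simp only [map_add, map_mul]
      field_simp
      ring }

theorem evalAt_eq {p : Fin (n + 1) → k} {hp : p ≠ 0}
    {z : ProjTilde.RingAt (stdGrading k n) (closedPoint p hp)} {a b : PolyRing k n}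
    (hb : b ∈ (closedPoint p hp).asHomogeneousIdeal.toIdeal.primeCompl)
    (hb' : MvPolynomial.eval p b ≠ 0) (h : z.val = Localization.mk a ⟨b, hb⟩) :
    evalAt p hp z = MvPolynomial.eval p a / MvPolynomial.eval p b :=
  eval_div_eval hb hb' h

end ClosedPoint

/-! ### Common denominators and sums of fractions. -/

namespace ProjTilde

variable {A σ : Type u} [CommRing A] [SetLike σ A] [AddSubgroupClass σ A] {𝒜 : ℕ → σ}
  [GradedRing 𝒜] {M : Type u} [AddCommGroup M] [Module A M]

/-- Finitely many homogeneous fractions of degree zero have a common denominator. -/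
theorem exists_common_denominator {x : ProjectiveSpectrum 𝒜} {e : ℕ} (v : Fin e → RingAt 𝒜 x) :
    ∃ (d : ℕ) (a : Fin e → 𝒜 d) (b : 𝒜 d)
      (hb : (b : A) ∈ x.asHomogeneousIdeal.toIdeal.primeCompl),
      ∀ l, v l = HomogeneousLocalization.mk ⟨d, a l, b, hb⟩ := by
  classical
  have hb : ∏ l, (v l).den ∈ x.asHomogeneousIdeal.toIdeal.primeCompl :=
    prod_mem fun l _ => (v l).den_mem
  refine ⟨∑ l, (v l).deg, fun l => ⟨(v l).num * ∏ j ∈ Finset.univ.erase l, (v j).den, ?_⟩,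
    ⟨∏ l, (v l).den, SetLike.prod_mem_graded _ _ _ fun l _ => (v l).den_mem_deg⟩, hb,
    fun l => ?_⟩
  · rw [← Finset.add_sum_erase _ _ (Finset.mem_univ l)]
    exact SetLike.GradedMul.mul_mem (v l).num_mem_deg
      (SetLike.prod_mem_graded _ _ _ fun j _ => (v j).den_mem_deg)
  · refine HomogeneousLocalization.val_injective _ ?_
    rw [HomogeneousLocalization.val_mk, (v l).eq_num_div_den, Localization.mk_eq_mk_iff,
      Localization.r_iff_exists]
    refine ⟨1, ?_⟩
    simp only [OneMemClass.coe_one, one_mul]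
    rw [← Finset.mul_prod_erase _ _ (Finset.mem_univ l)]
    ring

theorem localizedModule_sum_mk {S : Submonoid A} {ι : Type*} (t : Finset ι) (f : ι → M) (s : S) :
    ∑ l ∈ t, LocalizedModule.mk (f l) s = LocalizedModule.mk (∑ l ∈ t, f l) s := by
  refine (map_sum (AddMonoidHom.mk' (fun m : M => LocalizedModule.mk m s) fun a b => ?_) f t).symm
  rw [LocalizedModule.mk_add_mk, ← smul_add, LocalizedModule.mk_cancel_common_left]

/-- The factors `q` and `t` serve to turn generators of degree `m` into degree-zero fractions `q •
gen l / t`; the coefficients absorb the inverse factor. -/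
theorem localizedModule_mk_sum_smul {S : Submonoid A} {e : ℕ} (v : Fin e → A) (gen : Fin e → M)
    (s q t : S) :
    LocalizedModule.mk (∑ l, v l • gen l) s =
      ∑ l, Localization.mk (v l * t) (s * q) • LocalizedModule.mk ((q : A) • gen l) t := by
  simp_rw [LocalizedModule.mk_smul_mk]
  rw [localizedModule_sum_mk]
  have h : ∀ l, (v l * t) • (q : A) • gen l = ((q * t : S) : A) • v l • gen l := by
    intro l
    rw [smul_smul, smul_smul, Submonoid.coe_mul]
    congr 1
    ring
  simp_rw [h]
  rw [← Finset.smul_sum, mul_assoc, mul_comm s]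
  exact (LocalizedModule.mk_cancel_common_left _ _ _).symm

/-- The action of the local ring of `Proj A` at `x` on the localization of `M` at `x`. -/
abbrev locAtModule (𝒜 : ℕ → σ) [GradedRing 𝒜] (M : Type u) [AddCommGroup M] [Module A M]
    (x : ProjectiveSpectrum 𝒜) : Module (RingAt 𝒜 x) (LocAt 𝒜 M x) :=
  Module.compHom _ (algebraMap (RingAt 𝒜 x) (Localization.AtPrime x.asHomogeneousIdeal.toIdeal))

end ProjTilde

/-! ### Linear presentations of vector bundles -/

section LinearPresentation

variable {k : Type u} [Field k] {n : ℕ}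

open Matrix ProjTilde

theorem X_mem_primeCompl {p : Fin (n + 1) → k} (hp : p ≠ 0) {i : Fin (n + 1)} (hi : p i ≠ 0) :
    (MvPolynomial.X i : PolyRing k n) ∈
      (closedPoint p hp).asHomogeneousIdeal.toIdeal.primeCompl := fun h =>
  hi (by simpa using (mem_closedPoint (MvPolynomial.isHomogeneous_X k i)).1 h)

/-- The matrix of degree zero fractions `D / xᵢ`, where `D` is a matrix of linear forms. -/
def dehomogenize {g g' : ℕ} {D : Matrix (Fin g) (Fin g') (PolyRing k n)}
    (hD : ∀ l j, (D l j).IsHomogeneous 1) {p : Fin (n + 1) → k} (hp : p ≠ 0) {i : Fin (n + 1)}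
    (hi : p i ≠ 0) :
    Matrix (Fin g) (Fin g') (RingAt (stdGrading k n) (closedPoint p hp)) :=
  Matrix.of fun l j => HomogeneousLocalization.mk ⟨1, ⟨D l j, hD l j⟩,
    ⟨MvPolynomial.X i, MvPolynomial.isHomogeneous_X k i⟩, X_mem_primeCompl hp hi⟩

theorem val_dehomogenize {g g' : ℕ} {D : Matrix (Fin g) (Fin g') (PolyRing k n)}
    (hD : ∀ l j, (D l j).IsHomogeneous 1) {p : Fin (n + 1) → k} (hp : p ≠ 0) {i : Fin (n + 1)}
    (hi : p i ≠ 0) (l : Fin g) (j : Fin g') :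
    (dehomogenize hD hp hi l j).val =
      Localization.mk (D l j) ⟨MvPolynomial.X i, X_mem_primeCompl hp hi⟩ := rfl

theorem evalAt_dehomogenize {g g' : ℕ} {D : Matrix (Fin g) (Fin g') (PolyRing k n)}
    (hD : ∀ l j, (D l j).IsHomogeneous 1) {p : Fin (n + 1) → k} (hp : p ≠ 0) {i : Fin (n + 1)}
    (hi : p i ≠ 0) :
    (dehomogenize hD hp hi).map (evalAt p hp) = (p i)⁻¹ • D.map (MvPolynomial.eval p) := by
  ext l j
  rw [Matrix.map_apply, evalAt_eq (X_mem_primeCompl hp hi) (by simpa using hi)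
    (val_dehomogenize hD hp hi l j)]
  simp [div_eq_inv_mul]

variable {M : Type u} [AddCommGroup M] [Module (PolyRing k n) M]
  {ℳ : ModuleGrading (stdGrading k n) M} {m : ℤ} {g g' : ℕ} {gen : Fin g → M}
  {D : Matrix (Fin g) (Fin g') (PolyRing k n)}

theorem sum_dehomogenize_smul (hD : ∀ l j, (D l j).IsHomogeneous 1)
    (hexact : LinearMap.range D.mulVecLin =
      LinearMap.ker (Fintype.linearCombination (PolyRing k n) gen))
    {p : Fin (n + 1) → k} (hp : p ≠ 0) {i : Fin (n + 1)} (hi : p i ≠ 0)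
    (q : PolyRing k n) (t : (closedPoint p hp).asHomogeneousIdeal.toIdeal.primeCompl)
    (j : Fin g') :
    ∑ l, smulAt (dehomogenize hD hp hi l j)
      (LocalizedModule.mk (q • gen l) t : LocAt (stdGrading k n) M (closedPoint p hp)) = 0 := by
  have h1 : ∑ l, D l j • gen l = 0 := by
    have : D.mulVecLin (Pi.single j 1) ∈
        LinearMap.ker (Fintype.linearCombination (PolyRing k n) gen) :=
      hexact ▸ LinearMap.mem_range_self _ _
    simpa [Fintype.linearCombination_apply] using this
  simp_rw [smulAt, val_dehomogenize, LocalizedModule.mk_smul_mk]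
  rw [localizedModule_sum_mk]
  simp_rw [smul_comm _ q]
  rw [← Finset.smul_sum, h1, smul_zero, LocalizedModule.zero_mk]

/-- Relations between the generators of the stalk of `M~` come from the presentation. -/
theorem exists_mulVec_dehomogenize (hgen : ∀ l, gen l ∈ ℳ.piece m)
    (hD : ∀ l j, (D l j).IsHomogeneous 1)
    (hexact : LinearMap.range D.mulVecLin =
      LinearMap.ker (Fintype.linearCombination (PolyRing k n) gen))
    {p : Fin (n + 1) → k} (hp : p ≠ 0) {i : Fin (n + 1)} (hi : p i ≠ 0)
    {q : PolyRing k n} {β : ℕ} (hq : q ∈ stdGrading k n β)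
    (hq' : q ∈ (closedPoint p hp).asHomogeneousIdeal.toIdeal.primeCompl)
    (t : (closedPoint p hp).asHomogeneousIdeal.toIdeal.primeCompl)
    (v : Fin g → RingAt (stdGrading k n) (closedPoint p hp))
    (hv : ∑ l, smulAt (v l)
      (LocalizedModule.mk (q • gen l) t : LocAt (stdGrading k n) M (closedPoint p hp)) = 0) :
    ∃ w, v = dehomogenize hD hp hi *ᵥ w := by
  obtain ⟨d, a, b, hb, hab⟩ := exists_common_denominator v
  simp_rw [smulAt, hab, HomogeneousLocalization.val_mk, LocalizedModule.mk_smul_mk] at hv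
  replace hv := (localizedModule_sum_mk Finset.univ
    (fun l => (a l : PolyRing k n) • q • gen l) (⟨b, hb⟩ * t)).symm.trans hv
  obtain ⟨u, hu, hum⟩ := IsFracAt.eq_zero_iff (x := closedPoint p hp) ⟨_, rfl⟩ |>.1 hv
  have hgr : ∀ l, (a l : PolyRing k n) • q • gen l ∈ ℳ.piece (d + (β + m)) :=
    fun l => ℳ.smul_mem (a l).2 (ℳ.smul_mem hq (hgen l))
  obtain ⟨e, y, hy, hyx, hym⟩ := exists_homogeneous_smul_eq_zero ℳ (closedPoint p hp)
    (sum_mem fun l _ => hgr l) hu hum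
  -- The extra factor `X i` compensates for the denominator of `D / X i`: if `D c = w`, then `c / (y
  -- b q)` has degree zero and is mapped to `a / b`.
  let w : Fin g → PolyRing k n := fun l => MvPolynomial.X i * (y * ((a l : PolyRing k n) * q))
  have hw : w ∈ LinearMap.range D.mulVecLin := by
    rw [hexact, LinearMap.mem_ker, Fintype.linearCombination_apply]
    simp_rw [w, mul_smul, ← Finset.smul_sum]
    rw [hym, smul_zero]
  obtain ⟨c, hc⟩ := hw
  have hDgr : (freeGrading fun _ : Fin g' => (1 : ℤ)).IsGradedHom (freeGrading fun _ : Fin g => 0)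
      D.mulVecLin := isGradedHom_mulVecLin fun l j => by
    simpa using (isHomogeneousOfDegree_natCast (d := 1)).2 (hD l j)
  have hwgr : w ∈ (freeGrading fun _ : Fin g => (0 : ℤ)).piece ((e + (d + β) : ℕ) + 1) := by
    intro l
    refine Or.inr ⟨1 + (e + (d + β)), by push_cast; ring, ?_⟩
    exact (MvPolynomial.isHomogeneous_X k i).mul
      (MvPolynomial.IsHomogeneous.mul hy (MvPolynomial.IsHomogeneous.mul (a l).2 hq))
  set c' := (freeGrading fun _ : Fin g' => (1 : ℤ)).comp ((e + (d + β) : ℕ) + 1) c with hc'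
  have hDc' : D *ᵥ c' = w := by
    have := hDgr.map_comp ((e + (d + β) : ℕ) + 1) c
    rwa [hc, ModuleGrading.comp_of_mem hwgr] at this
  have hc'gr : ∀ j, (c' j).IsHomogeneous (e + (d + β)) := by
    intro j
    have := ModuleGrading.comp_mem (freeGrading fun _ : Fin g' => (1 : ℤ))
      ((e + (d + β) : ℕ) + 1) c j
    rw [add_sub_cancel_right] at this
    exact isHomogeneousOfDegree_natCast.1 this
  have hden : y * (b * q) ∈ (closedPoint p hp).asHomogeneousIdeal.toIdeal.primeCompl :=
    mul_mem (show y ∈ _ from hyx) (mul_mem hb hq')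
  refine ⟨fun j => HomogeneousLocalization.mk ⟨e + (d + β), ⟨c' j, hc'gr j⟩, ⟨y * (b * q),
    MvPolynomial.IsHomogeneous.mul hy (MvPolynomial.IsHomogeneous.mul b.2 hq)⟩, hden⟩,
    funext fun l => HomogeneousLocalization.val_injective _ ?_⟩
  have hsum : ((dehomogenize hD hp hi *ᵥ fun j => HomogeneousLocalization.mk ⟨e + (d + β),
      ⟨c' j, hc'gr j⟩, ⟨y * (b * q), MvPolynomial.IsHomogeneous.mul hy
        (MvPolynomial.IsHomogeneous.mul b.2 hq)⟩, hden⟩) l).val =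
      Localization.mk (∑ j, D l j * c' j)
        (⟨MvPolynomial.X i, X_mem_primeCompl hp hi⟩ * ⟨y * (b * q), hden⟩) := by
    rw [Localization.mk_sum, Matrix.mulVec, dotProduct,
      ← HomogeneousLocalization.algebraMap_apply, map_sum]
    refine Finset.sum_congr rfl fun j _ => ?_
    rw [HomogeneousLocalization.algebraMap_apply, HomogeneousLocalization.val_mul,
      val_dehomogenize, HomogeneousLocalization.val_mk, Localization.mk_mul]
  have hDl : ∑ j, D l j * c' j = w l := congrFun hDc' l
  rw [hsum, hDl, hab, HomogeneousLocalization.val_mk, Localization.mk_eq_mk_iff,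
    Localization.r_iff_exists]
  refine ⟨1, ?_⟩
  simp only [w, Submonoid.coe_mul, OneMemClass.coe_one, one_mul]
  ring

/-- If `M~` is a vector bundle, a linear presentation of `M` splits in the stalks. -/
theorem exists_stalk_splitting (hgen : ∀ l, gen l ∈ ℳ.piece m)
    (hD : ∀ l j, (D l j).IsHomogeneous 1)
    (hsurj : Function.Surjective (Fintype.linearCombination (PolyRing k n) gen))
    (hexact : LinearMap.range D.mulVecLin =
      LinearMap.ker (Fintype.linearCombination (PolyRing k n) gen))
    {r : ℕ} (hr : IsVectorBundleOfRank (tilde ℳ) r)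
    {p : Fin (n + 1) → k} (hp : p ≠ 0) {i : Fin (n + 1)} (hi : p i ≠ 0) :
    ∃ (Φ : Matrix (Fin r) (Fin g) (RingAt (stdGrading k n) (closedPoint p hp)))
      (S : Matrix (Fin g) (Fin r) (RingAt (stdGrading k n) (closedPoint p hp)))
      (C : Matrix (Fin g') (Fin g) (RingAt (stdGrading k n) (closedPoint p hp))),
      Φ * S = 1 ∧ Φ * dehomogenize hD hp hi = 0 ∧ S * Φ + dehomogenize hD hp hi * C = 1 := by
  obtain ⟨σ, hσ, hσspan, hσli⟩ := exists_stalk_basis ℳ hr (closedPoint p hp)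
  let := locAtModule (stdGrading k n) M (closedPoint p hp)
  -- With `α - β = m`, the fraction `X i ^ β • gen l / X i ^ α` has degree zero whatever the sign of
  -- `m`.
  obtain ⟨α, β, hαβ⟩ : ∃ α β : ℕ, (α : ℤ) = β + m := ⟨m.toNat, (-m).toNat, by omega⟩
  have hX : ∀ e, (MvPolynomial.X i : PolyRing k n) ^ e ∈ stdGrading k n e := fun e => by
    simpa using (MvPolynomial.isHomogeneous_X k i).pow e
  have hX' : ∀ e, (MvPolynomial.X i : PolyRing k n) ^ e ∈
    (closedPoint p hp).asHomogeneousIdeal.toIdeal.primeCompl :=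
    fun e => pow_mem (X_mem_primeCompl hp hi) e
  refine exists_splitting_of_presentation (σ := σ)
    (g := fun l => (LocalizedModule.mk ((MvPolynomial.X i ^ β : PolyRing k n) • gen l)
      ⟨MvPolynomial.X i ^ α, hX' α⟩ : LocAt (stdGrading k n) M (closedPoint p hp)))
    hσli (fun l => ?_) (fun j => ?_) (sum_dehomogenize_smul hD hexact hp hi _ _)
    (exists_mulVec_dehomogenize hgen hD hexact hp hi (hX β) (hX' β) _)
  · refine hσspan α _ _ ?_ (hX α) _ ⟨hX' α, rfl⟩
    rw [hαβ]
    exact ℳ.smul_mem (hX β) (hgen l)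
  · obtain ⟨d, x, s, hx, hs, hs', hσj⟩ := hσ j
    obtain ⟨v₀, hv₀⟩ := hsurj x
    set v := (freeGrading fun _ : Fin g => m).comp d v₀ with hv
    have hvx : ∑ l, v l • gen l = x := by
      have := (isGradedHom_linearCombination ℳ hgen).map_comp d v₀
      rwa [hv₀, ModuleGrading.comp_of_mem hx, Fintype.linearCombination_apply] at this
    have hvgr : ∀ l, v l * MvPolynomial.X i ^ α ∈ stdGrading k n (d + β) := by
      intro l
      have h1 := (ModuleGrading.comp_mem (freeGrading fun _ : Fin g => m) d v₀ l).mul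
        (isHomogeneousOfDegree_natCast.2 (hX α))
      rw [show (d : ℤ) - m + α = (d + β : ℕ) by push_cast; omega] at h1
      exact isHomogeneousOfDegree_natCast.1 h1
    refine ⟨fun l => HomogeneousLocalization.mk ⟨d + β, ⟨_, hvgr l⟩,
      ⟨s * MvPolynomial.X i ^ β, MvPolynomial.IsHomogeneous.mul hs (hX β)⟩,
      mul_mem hs' (hX' β)⟩, ?_⟩
    rw [hσj, ← hvx]
    exact localizedModule_mk_sum_smul v gen ⟨s, hs'⟩ ⟨MvPolynomial.X i ^ β, hX' β⟩
      ⟨MvPolynomial.X i ^ α, hX' α⟩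

theorem rank_smul_of_ne_zero {K : Type*} [Field K] {e c : ℕ} {a : K} (ha : a ≠ 0)
    (D : Matrix (Fin e) (Fin c) K) : (a • D).rank = D.rank := by
  have h : (a • D).mulVecLin = a • D.mulVecLin :=
    LinearMap.ext fun v => Matrix.smul_mulVec a D v
  rw [Matrix.rank, Matrix.rank, h, LinearMap.range_smul _ _ ha]

/-- If `M~` is a vector bundle of rank `r`, then a linear presentation matrix of `M` has constant
corank `r`. -/
theorem rank_eval_add (hgen : ∀ l, gen l ∈ ℳ.piece m) (hD : ∀ l j, (D l j).IsHomogeneous 1)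
    (hsurj : Function.Surjective (Fintype.linearCombination (PolyRing k n) gen))
    (hexact : LinearMap.range D.mulVecLin =
      LinearMap.ker (Fintype.linearCombination (PolyRing k n) gen))
    {r : ℕ} (hr : IsVectorBundleOfRank (tilde ℳ) r) {p : Fin (n + 1) → k} (hp : p ≠ 0) :
    (D.map (MvPolynomial.eval p)).rank + r = g := by
  obtain ⟨i, hi⟩ := Function.ne_iff.1 hp
  obtain ⟨Φ, S, C, h₁, h₂, h₃⟩ := exists_stalk_splitting hgen hD hsurj hexact hr hp hi
  have h := rank_add_of_splitting (Φ := Φ.map (evalAt p hp)) (S := S.map (evalAt p hp))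
    (C := C.map (evalAt p hp)) (D := (dehomogenize hD hp hi).map (evalAt p hp))
    (by rw [← Matrix.map_mul, h₁, Matrix.map_one _ (map_zero _) (map_one _)])
    (by rw [← Matrix.map_mul, h₂, Matrix.map_zero _ (map_zero _)])
    (by rw [← Matrix.map_mul, ← Matrix.map_mul, ← Matrix.map_add _ (map_add _), h₃,
          Matrix.map_one _ (map_zero _) (map_one _)])
  rwa [evalAt_dehomogenize, rank_smul_of_ne_zero (inv_ne_zero hi)] at h

/-- If `M~` is a vector bundle, then the kernel of a linear presentation matrix of `M` at a point is
spanned by the values of syzygies. -/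
theorem exists_syzygy_eval_eq (hgen : ∀ l, gen l ∈ ℳ.piece m)
    (hD : ∀ l j, (D l j).IsHomogeneous 1)
    (hsurj : Function.Surjective (Fintype.linearCombination (PolyRing k n) gen))
    (hexact : LinearMap.range D.mulVecLin =
      LinearMap.ker (Fintype.linearCombination (PolyRing k n) gen))
    {r : ℕ} (hr : IsVectorBundleOfRank (tilde ℳ) r) {p : Fin (n + 1) → k} (hp : p ≠ 0)
    (w₀ : Fin g' → k) (hw₀ : D.map (MvPolynomial.eval p) *ᵥ w₀ = 0) :
    ∃ w : Fin g' → PolyRing k n, D *ᵥ w = 0 ∧ ∀ j, MvPolynomial.eval p (w j) = w₀ j := by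
  obtain ⟨i, hi⟩ := Function.ne_iff.1 hp
  obtain ⟨Φ, S, C, h₁, h₂, h₃⟩ := exists_stalk_splitting hgen hD hsurj hexact hr hp hi
  set D' := dehomogenize hD hp hi with hD'
  have hDCD : D' * C * D' = D' := mul_mul_of_splitting h₂ h₃
  have hconst : ∀ a : k, (MvPolynomial.C a : PolyRing k n) ∈ stdGrading k n 0 :=
    fun a => MvPolynomial.isHomogeneous_C _ a
  let γ : Fin g' → RingAt (stdGrading k n) (closedPoint p hp) := fun j =>
    HomogeneousLocalization.mk ⟨0, ⟨MvPolynomial.C (w₀ j), hconst _⟩,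
      ⟨1, SetLike.GradedOne.one_mem⟩, one_mem _⟩
  have hγ : ∀ j, evalAt p hp (γ j) = w₀ j := by
    intro j
    rw [evalAt_eq (z := γ j) (one_mem _) (by simp) rfl]
    simp
  -- The constant lift `γ` of `w₀` is projected into `ker D'`. As `D' γ` vanishes at `p`, the
  -- correction does not change the value there.
  let v := γ - C *ᵥ (D' *ᵥ γ)
  have hv : D' *ᵥ v = 0 := by
    rw [Matrix.mulVec_sub, Matrix.mulVec_mulVec, Matrix.mulVec_mulVec, hDCD,
      sub_self]
  have hve : ∀ j, evalAt p hp (v j) = w₀ j := by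
    intro j
    have h0 : ∀ l, evalAt p hp ((D' *ᵥ γ) l) = 0 := by
      intro l
      rw [RingHom.map_mulVec, evalAt_dehomogenize]
      have : (evalAt p hp) ∘ γ = w₀ := funext hγ
      rw [this, Matrix.smul_mulVec, hw₀, smul_zero]
      rfl
    simp only [v, Pi.sub_apply, map_sub, hγ]
    rw [RingHom.map_mulVec]
    have : (evalAt p hp) ∘ (D' *ᵥ γ) = 0 := funext h0
    rw [this, Matrix.mulVec_zero]
    simp
  -- The numerators over a common denominator form a polynomial syzygy; dividing by the scalar
  -- `b(p)` restores the value `w₀`.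
  obtain ⟨d, a, b, hb, hab⟩ := exists_common_denominator v
  have hbp : MvPolynomial.eval p (b : PolyRing k n) ≠ 0 :=
    fun h => hb ((mem_closedPoint b.2).2 h)
  refine ⟨fun j => MvPolynomial.C (MvPolynomial.eval p (b : PolyRing k n))⁻¹ *
    (a j : PolyRing k n), ?_,
    fun j => ?_⟩
  · have hDa : D *ᵥ (fun j => (a j : PolyRing k n)) = 0 := by
      funext l
      have h1 := congrArg HomogeneousLocalization.val (congrFun hv l)
      rw [Pi.zero_apply, HomogeneousLocalization.val_zero, Matrix.mulVec, dotProduct,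
        ← HomogeneousLocalization.algebraMap_apply, map_sum] at h1
      have h2 : ∀ j, algebraMap _ (Localization _) (D' l j * v j) =
          Localization.mk (D l j * a j) (⟨MvPolynomial.X i, X_mem_primeCompl hp hi⟩ * ⟨b, hb⟩) := by
        intro j
        rw [HomogeneousLocalization.algebraMap_apply, HomogeneousLocalization.val_mul,
          val_dehomogenize, hab, HomogeneousLocalization.val_mk, Localization.mk_mul]
      simp_rw [h2] at h1
      rw [← Localization.mk_sum, ← Localization.mk_zero 1] at h1
      simpa [Matrix.mulVec, dotProduct] using localization_mk_eq_mk h1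
    have : (fun j => MvPolynomial.C (MvPolynomial.eval p (b : PolyRing k n))⁻¹ *
        (a j : PolyRing k n)) = (MvPolynomial.C (MvPolynomial.eval p (b : PolyRing k n))⁻¹ :
          PolyRing k n) • fun j => (a j : PolyRing k n) := rfl
    rw [this, Matrix.mulVec_smul, hDa, smul_zero]
  · have := hve j
    rw [evalAt_eq (z := v j) hb hbp (by rw [hab]; rfl)] at this
    rw [map_mul, MvPolynomial.eval_C, ← this]
    field_simp

end LinearPresentation

/-! ### Constant matrices -/

section ConstantMatrices

open Matrix MvPolynomial

variable {k : Type u} [Field k] {n : ℕ}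

theorem map_C_mulVec {ι κ : Type*} [Fintype κ] (B : Matrix ι κ k) (v : κ → k) :
    (B.map C : Matrix ι κ (PolyRing k n)) *ᵥ (C ∘ v) = C ∘ (B *ᵥ v) :=
  funext fun i => (RingHom.map_mulVec C B v i).symm

theorem C_comp_zero {ι : Type*} : (C ∘ (0 : ι → k) : ι → PolyRing k n) = 0 := by
  ext1
  simp

theorem mulVec_eq_sum_col {R ι κ : Type*} [CommSemiring R] [Fintype κ] (D : Matrix ι κ R)
    (v : κ → R) : D *ᵥ v = ∑ j, v j • D.col j := by
  ext i
  simp [Matrix.mulVec, dotProduct, mul_comm]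

theorem constantCoeff_map_C_mulVec {ι κ : Type*} [Fintype κ] (B : Matrix ι κ k)
    (v : κ → PolyRing k n) (i : ι) :
    constantCoeff (((B.map C : Matrix ι κ (PolyRing k n)) *ᵥ v) i) =
      (B *ᵥ (constantCoeff ∘ v)) i := by
  rw [RingHom.map_mulVec, Matrix.map_map]
  congr 2
  ext
  simp

theorem eval_map_C_mulVec {ι κ : Type*} [Fintype κ] (B : Matrix ι κ k)
    (p : Fin (n + 1) → k) (v : κ → PolyRing k n) (i : ι) :
    eval p (((B.map C : Matrix ι κ (PolyRing k n)) *ᵥ v) i) = (B *ᵥ (eval p ∘ v)) i := by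
  rw [RingHom.map_mulVec, Matrix.map_map]
  congr 2
  ext
  simp

theorem map_C_map_eval {ι κ : Type*} (B : Matrix ι κ k) (p : Fin (n + 1) → k) :
    (B.map C : Matrix ι κ (PolyRing k n)).map (eval p) = B := by
  ext
  simp

theorem constantCoeff_mulVec_eq_zero {ι κ : Type*} [Fintype κ] {D : Matrix ι κ (PolyRing k n)}
    (hD : ∀ i j, constantCoeff (D i j) = 0) (v : κ → PolyRing k n) (i : ι) :
    constantCoeff ((D *ᵥ v) i) = 0 := by
  rw [RingHom.map_mulVec]
  have : D.map (constantCoeff (R := k)) = 0 := by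
    ext i j
    exact hD i j
  rw [this, Matrix.zero_mulVec, Pi.zero_apply]

/-- A surjective constant matrix has a constant projection onto its kernel. -/
theorem exists_projection_ker {ι κ : Type*} [Fintype ι] [Fintype κ] [DecidableEq ι] [DecidableEq κ]
    {B : Matrix ι κ k} (hB : Function.Surjective B.mulVec) :
    ∃ T : Matrix κ κ k, B * T = 0 ∧ ∀ y : κ → PolyRing k n,
      (B.map C : Matrix ι κ (PolyRing k n)) *ᵥ y = 0 →
        (T.map C : Matrix κ κ (PolyRing k n)) *ᵥ y = y := by
  obtain ⟨B', hB'⟩ := mulVec_surjective_iff_exists_right_inverse.1 hB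
  refine ⟨1 - B' * B, ?_, fun y hy => ?_⟩
  · rw [Matrix.mul_sub, Matrix.mul_one, ← Matrix.mul_assoc, hB', Matrix.one_mul, sub_self]
  · rw [Matrix.map_sub _ (map_sub _), Matrix.map_mul, Matrix.map_one _ (map_zero _) (map_one _),
      Matrix.sub_mulVec, Matrix.one_mulVec, ← Matrix.mulVec_mulVec, hy, Matrix.mulVec_zero,
      sub_zero]

theorem exists_left_inverse_of_injective {ι κ : Type*} [Fintype ι] [Fintype κ] [DecidableEq ι]
    [DecidableEq κ] {B : Matrix ι κ k} (hB : ∀ v, B *ᵥ v = 0 → v = 0) :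
    ∃ B' : Matrix κ ι k, B' * B = 1 := by
  obtain ⟨g, hg⟩ := B.mulVecLin.exists_leftInverse_of_injective
    (LinearMap.ker_eq_bot'.2 fun v => hB v)
  refine ⟨LinearMap.toMatrix' g, Matrix.ext_of_mulVec_single fun i => ?_⟩
  rw [← Matrix.mulVec_mulVec, LinearMap.toMatrix'_mulVec, Matrix.one_mulVec]
  exact LinearMap.congr_fun hg _

theorem map_C_mulVec_injective {ι κ : Type*} [Fintype ι] [Fintype κ] [DecidableEq ι]
    [DecidableEq κ] {B : Matrix ι κ k} (hB : ∀ v, B *ᵥ v = 0 → v = 0) (y : κ → PolyRing k n)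
    (hy : (B.map C : Matrix ι κ (PolyRing k n)) *ᵥ y = 0) : y = 0 := by
  obtain ⟨B', hB'⟩ := exists_left_inverse_of_injective hB
  have h : (B'.map C : Matrix κ ι (PolyRing k n)) *ᵥ
      ((B.map C : Matrix ι κ (PolyRing k n)) *ᵥ y) = y := by
    rw [Matrix.mulVec_mulVec, ← Matrix.map_mul, hB',
      Matrix.map_one _ (map_zero _) (map_one _), Matrix.one_mulVec]
  rw [← h, hy, Matrix.mulVec_zero]

/-- An exact sequence of constant matrices remains exact over the polynomial ring. -/
theorem exists_map_C_mulVec_eq {ι κ ρ : Type*} [Fintype ι] [Fintype κ] [Fintype ρ] [DecidableEq ι]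
    [DecidableEq κ] {B : Matrix ι κ k} (hB : Function.Surjective B.mulVec) {Γ : Matrix κ ρ k}
    (hΓ : ∀ v, B *ᵥ v = 0 → ∃ w, Γ *ᵥ w = v) :
    ∃ T : Matrix ρ κ k, ∀ y : κ → PolyRing k n,
      (B.map C : Matrix ι κ (PolyRing k n)) *ᵥ y = 0 →
        (Γ.map C : Matrix κ ρ (PolyRing k n)) *ᵥ
          ((T.map C : Matrix ρ κ (PolyRing k n)) *ᵥ y) = y := by
  obtain ⟨Q, hQ, hQ'⟩ := exists_projection_ker (n := n) hB
  have h : ∀ i, ∃ w, Γ *ᵥ w = Q *ᵥ Pi.single i 1 := fun i => hΓ _ (by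
    rw [Matrix.mulVec_mulVec, hQ, Matrix.zero_mulVec])
  choose T hT using h
  have hΓT : Γ * (Matrix.of T)ᵀ = Q := Matrix.ext_of_mulVec_single fun i => by
    rw [← Matrix.mulVec_mulVec, ← hT]
    congr 1
    ext
    simp
  refine ⟨(Matrix.of T)ᵀ, fun y hy => ?_⟩
  rw [Matrix.mulVec_mulVec, ← Matrix.map_mul, hΓT, hQ' y hy]

/-- A dimension count along `0 → k^ρ → k^κ → k^ι → 0`, which produces both `a` and `b`. -/
theorem card_add_card_of_exact {ι κ ρ : Type*} [Fintype ι] [Fintype κ] [Fintype ρ]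
    {B : Matrix ι κ k} (hB : Function.Surjective B.mulVec) {Γ : Matrix κ ρ k}
    (hΓ : ∀ v, Γ *ᵥ v = 0 → v = 0) (hker : ∀ v, B *ᵥ v = 0 ↔ ∃ w, Γ *ᵥ w = v) :
    Fintype.card ρ + Fintype.card ι = Fintype.card κ := by
  have h : LinearMap.range Γ.mulVecLin = LinearMap.ker B.mulVecLin := by
    ext v
    rw [LinearMap.mem_ker, LinearMap.mem_range]
    exact (hker v).symm
  have h1 := LinearMap.finrank_range_add_finrank_ker B.mulVecLin
  rw [← h, LinearMap.finrank_range_of_inj (LinearMap.ker_eq_bot.1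
    (LinearMap.ker_eq_bot'.2 fun v => hΓ v)), LinearMap.range_eq_top.2 hB, finrank_top] at h1
  simp only [Module.finrank_fintype_fun_eq_card] at h1
  omega

theorem finrank_map_add_finrank_ker_of_le {V W : Type*} [AddCommGroup V] [Module k V]
    [FiniteDimensional k V] [AddCommGroup W] [Module k W] (f : V →ₗ[k] W) (U : Submodule k V)
    (h : LinearMap.ker f ≤ U) :
    Module.finrank k (U.map f) + Module.finrank k (LinearMap.ker f) = Module.finrank k U := by
  have h1 := LinearMap.finrank_range_add_finrank_ker (f.domRestrict U)
  rw [LinearMap.range_domRestrict, LinearMap.ker_domRestrict] at h1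
  rw [← h1]
  congr 1
  exact (LinearEquiv.finrank_eq (Submodule.comapSubtypeEquivOfLe h)).symm

theorem rank_mul_of_injective {ι κ ρ : Type*} [Fintype ι] [Fintype κ] [Fintype ρ]
    {Γ : Matrix ι κ k} (hΓ : ∀ v, Γ *ᵥ v = 0 → v = 0) (A : Matrix κ ρ k) :
    (Γ * A).rank = A.rank := by
  have hbot : LinearMap.ker Γ.mulVecLin = ⊥ := LinearMap.ker_eq_bot'.2 fun v => hΓ v
  have h := finrank_map_add_finrank_ker_of_le Γ.mulVecLin (LinearMap.range A.mulVecLin)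
    (hbot ▸ bot_le)
  rw [hbot, finrank_bot, add_zero] at h
  rw [Matrix.rank, Matrix.rank, Matrix.mulVecLin_mul, LinearMap.range_comp, h]

end ConstantMatrices

/-! ### Minimal presentations of linearly generated modules -/

section LinearGeneration

open Matrix MvPolynomial

variable {k : Type u} [Field k] {n : ℕ}

theorem IsHomogeneousOfDegree.eq_C {p : PolyRing k n} (h : IsHomogeneousOfDegree p 0) :
    p = C (constantCoeff p) := by
  have h0 := (isHomogeneousOfDegree_natCast (d := 0)).1 h
  have h1 := homogeneousComponent_of_mem (m := 0) h0
  rw [if_pos rfl, homogeneousComponent_zero] at h1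
  exact h1.symm

theorem eq_map_C_of_isHomogeneousOfDegree_zero {ι κ : Type*} {B : Matrix ι κ (PolyRing k n)}
    (h : ∀ i j, IsHomogeneousOfDegree (B i j) 0) :
    B = ((B.map constantCoeff : Matrix ι κ k).map C : Matrix ι κ (PolyRing k n)) :=
  Matrix.ext fun i j => (h i j).eq_C

/-- If the value of a matrix of linear forms is linear, it is the value of a constant vector. -/
theorem exists_constant_mulVec_eq {e c : ℕ} {D : Matrix (Fin e) (Fin c) (PolyRing k n)}
    (hD : ∀ i j, (D i j).IsHomogeneous 1) {v : Fin c → PolyRing k n}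
    (hv : ∀ i, ((D *ᵥ v) i).IsHomogeneous 1) : ∃ w : Fin c → k, D *ᵥ (C ∘ w) = D *ᵥ v := by
  have hDgr : (freeGrading fun _ : Fin c => (1 : ℤ)).IsGradedHom (freeGrading fun _ : Fin e => 0)
      D.mulVecLin := isGradedHom_mulVecLin fun l j => by
    simpa using (isHomogeneousOfDegree_natCast (d := 1)).2 (hD l j)
  have h1 := hDgr.map_comp 1 v
  rw [ModuleGrading.comp_of_mem (x := D.mulVecLin v) (mem_freeGrading.2 fun i => by
    simpa using (isHomogeneousOfDegree_natCast (d := 1)).2 (hv i))] at h1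
  refine ⟨fun j => constantCoeff ((freeGrading fun _ : Fin c => (1 : ℤ)).comp 1 v j), ?_⟩
  rw [← Matrix.mulVecLin_apply D v, ← h1, Matrix.mulVecLin_apply]
  congr 1
  funext j
  have := ModuleGrading.comp_mem (freeGrading fun _ : Fin c => (1 : ℤ)) 1 v j
  rw [sub_self] at this
  exact this.eq_C.symm

variable {M : Type u} [AddCommGroup M] [Module (PolyRing k n) M]
  {ℳ : ModuleGrading (stdGrading k n) M} {m : ℤ}

/-- A homogeneous element of degree `m` is a combination with constant coefficients of generators of
degree `m`. -/
theorem exists_constant_linearCombination_eq {e : ℕ} {gen : Fin e → M}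
    (hgen : ∀ l, gen l ∈ ℳ.piece m)
    (hsurj : Function.Surjective (Fintype.linearCombination (PolyRing k n) gen)) {x : M}
    (hx : x ∈ ℳ.piece m) :
    ∃ c : Fin e → k, Fintype.linearCombination (PolyRing k n) gen (C ∘ c) = x := by
  obtain ⟨v, hv⟩ := hsurj x
  have h1 := (isGradedHom_linearCombination ℳ hgen).map_comp m v
  rw [hv, ModuleGrading.comp_of_mem hx] at h1
  refine ⟨fun l => constantCoeff ((freeGrading fun _ : Fin e => m).comp m v l), ?_⟩
  rw [← h1]
  congr 1
  funext l
  have := ModuleGrading.comp_mem (freeGrading fun _ : Fin e => m) m v l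
  rw [sub_self] at this
  exact this.eq_C.symm

/-- If a module is generated in degree `m`, then so is every minimal presentation. -/
theorem MinimalPresentation.deg0_eq (P : MinimalPresentation ℳ) {e : ℕ} {h : Fin e → M}
    (hh : ∀ i, h i ∈ ℳ.piece m)
    (hsurj : Function.Surjective (Fintype.linearCombination (PolyRing k n) h)) (l : Fin P.rk0) :
    P.deg0 l = m := by
  by_contra hne
  obtain ⟨v₀, hv₀⟩ := hsurj (P.gen l)
  have h1 := (isGradedHom_linearCombination ℳ hh).map_comp (P.deg0 l) v₀
  rw [hv₀, ModuleGrading.comp_of_mem (P.gen_mem l)] at h1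
  set v := (freeGrading fun _ : Fin e => m).comp (P.deg0 l) v₀
  have hv : ∀ i, constantCoeff (v i) = 0 := fun i =>
    IsHomogeneousOfDegree.constantCoeff_eq_zero
      (ModuleGrading.comp_mem (freeGrading fun _ : Fin e => m) (P.deg0 l) v₀ i)
      (sub_ne_zero.2 hne)
  choose q hq using fun i => P.surjective (h i)
  -- Rewriting the `h i` in the generators of `P` expresses `P.gen l` with coefficients free of
  -- constant terms. The resulting relation has constant term `1` at `l`, against minimality.
  have hmem : Pi.single l 1 - ∑ i, v i • q i ∈
      LinearMap.ker (Fintype.linearCombination (PolyRing k n) P.gen) := by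
    rw [LinearMap.mem_ker, map_sub, map_sum, Fintype.linearCombination_apply_single, one_smul,
      ← h1, Fintype.linearCombination_apply]
    simp_rw [map_smul, hq]
    exact sub_self _
  rw [← P.exact] at hmem
  obtain ⟨w, hw⟩ := hmem
  have h2 := constantCoeff_mulVec_eq_zero P.mat_minimal w l
  rw [← Matrix.mulVecLin_apply, hw] at h2
  simp [hv] at h2

/-- The relations of a minimal presentation with generators of degree `m` have degree at least
`m + 1`. -/
theorem MinimalPresentation.le_deg1 (P : MinimalPresentation ℳ) (h : ∀ l, P.deg0 l = m)
    (j : Fin P.rk1) : m + 1 ≤ P.deg1 j := by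
  by_contra hlt
  -- Entries of degree at most zero without constant term vanish; the basis vector at `j` would then
  -- be a syzygy with a unit entry.
  have hcol : ∀ l, P.mat l j = 0 := by
    intro l
    have h1 := P.mat_homogeneous l j
    rw [h l] at h1
    rcases (show P.deg1 j - m ≤ 0 by omega).lt_or_eq with h2 | h2
    · exact h1.eq_zero h2
    · rw [h2] at h1
      rw [h1.eq_C, P.mat_minimal, map_zero]
  have := P.syz_minimal (Pi.single j 1) (by
    rw [LinearMap.mem_ker, Matrix.mulVecLin_apply, Matrix.mulVec_single_one]
    exact funext hcol) j
  simp at this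

/-- Homogeneous relations of degree `m + 1` are constant combinations of the linear columns of a
minimal presentation. -/
theorem MinimalPresentation.exists_linear_relation (P : MinimalPresentation ℳ)
    (h : ∀ l, P.deg0 l = m) {y : Fin P.rk0 → PolyRing k n} (hy : ∀ l, (y l).IsHomogeneous 1)
    (hy' : Fintype.linearCombination (PolyRing k n) P.gen y = 0) :
    ∃ c : {j : Fin P.rk1 // P.deg1 j = m + 1} → k,
      (P.mat.submatrix id Subtype.val : Matrix (Fin P.rk0) {j : Fin P.rk1 // P.deg1 j = m + 1}
        (PolyRing k n)) *ᵥ (C ∘ c) = y := by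
  have hmem : y ∈ LinearMap.range P.mat.mulVecLin := by
    rw [P.exact]
    exact hy'
  obtain ⟨v₀, hv₀⟩ := hmem
  have h1 := (isGradedHom_mulVecLin P.mat_homogeneous).map_comp (m + 1) v₀
  rw [hv₀, ModuleGrading.comp_of_mem (x := y) (mem_freeGrading.2 fun l => by
    rw [h l, add_sub_cancel_left]
    exact (isHomogeneousOfDegree_natCast (d := 1)).2 (hy l))] at h1
  have hcomp := ModuleGrading.comp_mem (freeGrading P.deg1) (m + 1) v₀
  set v := (freeGrading P.deg1).comp (m + 1) v₀
  refine ⟨fun j => constantCoeff (v j), ?_⟩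
  rw [← h1]
  funext l
  -- All other columns have degree above `m + 1`, so their coefficients have negative degree.
  have h2 : ∀ j, P.deg1 j ≠ m + 1 → P.mat l j * v j = 0 := by
    intro j hj
    have := P.le_deg1 h j
    rw [(hcomp j).eq_zero (by omega), mul_zero]
  rw [Matrix.mulVecLin_apply, Matrix.mulVec, Matrix.mulVec, dotProduct, dotProduct]
  rw [← Fintype.sum_subtype_add_sum_subtype (fun j => P.deg1 j = m + 1),
    Finset.sum_eq_zero (s := (Finset.univ : Finset {j // ¬ P.deg1 j = m + 1}))
      (fun j _ => h2 j j.2), add_zero]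
  refine Finset.sum_congr rfl fun j _ => ?_
  have h3 := hcomp j
  rw [j.2, sub_self] at h3
  rw [Matrix.submatrix_apply, id, Function.comp_apply, ← h3.eq_C]

/-- Extended by zero, a constant dependency between the linear columns is a syzygy of `P.mat`, and
`syz_minimal` forbids nonzero constant entries. -/
theorem MinimalPresentation.linear_columns_injective (P : MinimalPresentation ℳ)
    (c : {j : Fin P.rk1 // P.deg1 j = m + 1} → k)
    (hc : (P.mat.submatrix id Subtype.val : Matrix (Fin P.rk0)
      {j : Fin P.rk1 // P.deg1 j = m + 1} (PolyRing k n)) *ᵥ (C ∘ c) = 0) : c = 0 := by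
  let v : Fin P.rk1 → PolyRing k n := fun j => if hj : P.deg1 j = m + 1 then C (c ⟨j, hj⟩) else 0
  have hv : v ∈ LinearMap.ker P.mat.mulVecLin := by
    rw [LinearMap.mem_ker, ← hc]
    funext l
    rw [Matrix.mulVecLin_apply, Matrix.mulVec, Matrix.mulVec, dotProduct, dotProduct,
      ← Fintype.sum_subtype_add_sum_subtype (fun j => P.deg1 j = m + 1),
      Finset.sum_eq_zero (s := (Finset.univ : Finset {j // ¬ P.deg1 j = m + 1}))
        (fun j _ => by simp [v, j.2]), add_zero]
    exact Finset.sum_congr rfl fun j _ => by simp [v, j.2]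
  funext j
  have := P.syz_minimal v hv j
  simpa [v, j.2] using this

end LinearGeneration

/-! ### Constant terms of syzygies, and linear resolutions. -/

section Resolutions

open Matrix MvPolynomial

variable {k : Type u} [Field k] {n : ℕ} {M : Type u} [AddCommGroup M] [Module (PolyRing k n) M]
  {ℳ : ModuleGrading (stdGrading k n) M}

namespace MinimalFreeResolution

/-- Relations are images under a matrix with entries in the irrelevant ideal. Hence constant vectors
can be compared after passing to the module. -/
theorem constantCoeff_of_aug_eq_zero (P : MinimalFreeResolution ℳ) {v : Fin (P.rk 0) → PolyRing k n}
    (hv : P.aug v = 0) (i : Fin (P.rk 0)) : constantCoeff (v i) = 0 := by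
  have h : v ∈ LinearMap.range (P.d 0).mulVecLin := by
    rw [P.exact_zero]
    exact hv
  obtain ⟨w, rfl⟩ := h
  exact constantCoeff_mulVec_eq_zero (P.d_minimal 0) w i

theorem constantCoeff_of_mulVec_eq_zero (P : MinimalFreeResolution ℳ) {j : ℕ}
    {v : Fin (P.rk (j + 1)) → PolyRing k n}
    (hv : P.d j *ᵥ v = 0) (i : Fin (P.rk (j + 1))) : constantCoeff (v i) = 0 := by
  have h : v ∈ LinearMap.range (P.d (j + 1)).mulVecLin := by
    rw [P.exact_succ]
    exact hv
  obtain ⟨w, rfl⟩ := h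
  exact constantCoeff_mulVec_eq_zero (P.d_minimal (j + 1)) w i

theorem aug_mulVec (P : MinimalFreeResolution ℳ) (w : Fin (P.rk 1) → PolyRing k n) :
    P.aug (P.d 0 *ᵥ w) = 0 := by
  have h : (P.d 0).mulVecLin w ∈ LinearMap.ker P.aug := by
    rw [aug, ← P.exact_zero]
    exact LinearMap.mem_range_self _ _
  exact h

theorem exists_mulVec_eq (P : MinimalFreeResolution ℳ) {v : Fin (P.rk 0) → PolyRing k n}
    (hv : P.aug v = 0) : ∃ w, P.d 0 *ᵥ w = v := by
  have h : v ∈ LinearMap.range (P.d 0).mulVecLin := by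
    rw [P.exact_zero]
    exact hv
  exact h

theorem IsLinearUpTo.isHomogeneous_one {P : MinimalFreeResolution ℳ} {m : ℤ} {N : ℕ}
    (h : P.IsLinearUpTo m N) {i : ℕ} (hi : i + 1 ≤ N) (l j) : (P.d i l j).IsHomogeneous 1 := by
  have h1 := P.d_homogeneous i l j
  rw [h i (by omega), h (i + 1) hi] at h1
  refine (isHomogeneousOfDegree_natCast (d := 1)).1 ?_
  convert h1 using 1
  push_cast
  ring

theorem IsLinearUpTo.betti_eq {P : MinimalFreeResolution ℳ} {m : ℤ} {N : ℕ}
    (h : P.IsLinearUpTo m N) {i : ℕ} (hi : i ≤ N) : P.betti i (m + i) = P.rk i := by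
  rw [betti, Fintype.card_congr (Equiv.subtypeUnivEquiv (h i hi)), Fintype.card_fin]

end MinimalFreeResolution

end Resolutions

/-! ### The kernel of a morphism of linearly presented modules -/

namespace MinimalFreeResolution.Lift

open Matrix MvPolynomial

variable {k : Type u} [Field k] {n : ℕ} {E G : Type u} [AddCommGroup E] [Module (PolyRing k n) E]
  [AddCommGroup G] [Module (PolyRing k n) G] {gradE : ModuleGrading (stdGrading k n) E}
  {gradG : ModuleGrading (stdGrading k n) G} {resE : MinimalFreeResolution gradE}
  {resG : MinimalFreeResolution gradG} {m : ℤ} {μ : E →ₗ[PolyRing k n] G}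
  (c : Lift resE resG μ)

/-- The constant terms of the matrix of `μ⁰`. -/
def const0 : Matrix (Fin (resG.rk 0)) (Fin (resE.rk 0)) k := c.mu0.map constantCoeff

/-- The constant terms of the matrix of `μ¹`. -/
def const1 : Matrix (Fin (resG.rk 1)) (Fin (resE.rk 1)) k := c.mu1.map constantCoeff

/-- Both free modules are generated in degree `m`, so a degree-preserving matrix between them has
entries of degree zero. -/
theorem mu0_eq (hE : resE.IsLinearUpTo m 1) (hG : resG.IsLinearUpTo m 2) :
    c.mu0 = c.const0.map C :=
  eq_map_C_of_isHomogeneousOfDegree_zero fun i j => by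
    have := c.mu0_homogeneous i j
    rwa [hE 0 (by omega), hG 0 (by omega), sub_self] at this

theorem mu1_eq (hE : resE.IsLinearUpTo m 1) (hG : resG.IsLinearUpTo m 2) :
    c.mu1 = c.const1.map C :=
  eq_map_C_of_isHomogeneousOfDegree_zero fun i j => by
    have := c.mu1_homogeneous i j
    rwa [hE 1 (by omega), hG 1 (by omega), sub_self] at this

theorem aug_mu0 (v : Fin (resE.rk 0) → PolyRing k n) :
    resG.aug (c.mu0 *ᵥ v) = μ (resE.aug v) :=
  LinearMap.congr_fun c.comm_zero v

theorem d_mu1 (v : Fin (resE.rk 1) → PolyRing k n) :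
    resG.d 0 *ᵥ (c.mu1 *ᵥ v) = c.mu0 *ᵥ (resE.d 0 *ᵥ v) := by
  rw [Matrix.mulVec_mulVec, c.comm_one, Matrix.mulVec_mulVec]

/-- Nakayama's lemma: a lift through `μ` agrees with the given constant vector up to a relation of
`G`, which has no constant term. -/
theorem const0_surjective (hE : resE.IsLinearUpTo m 1) (hG : resG.IsLinearUpTo m 2)
    (hμ : Function.Surjective μ) : Function.Surjective c.const0.mulVec := by
  intro w
  obtain ⟨x, hx⟩ := hμ (resG.aug (C ∘ w))
  obtain ⟨v, rfl⟩ := resE.surjective x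
  refine ⟨constantCoeff ∘ v, funext fun i => ?_⟩
  have h0 : resG.aug (C ∘ w - c.mu0 *ᵥ v) = 0 := by
    rw [map_sub, c.aug_mu0, ← hx]
    exact sub_self _
  have := resG.constantCoeff_of_aug_eq_zero h0 i
  rw [Pi.sub_apply, map_sub, c.mu0_eq hE hG, constantCoeff_map_C_mulVec, sub_eq_zero] at this
  simpa using this.symm

theorem const1_surjective (hE : resE.IsLinearUpTo m 1) (hG : resG.IsLinearUpTo m 2)
    (hμ : Function.Surjective c.mu1.mulVecLin) : Function.Surjective c.const1.mulVec := by
  intro w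
  obtain ⟨v, hv⟩ := hμ (C ∘ w)
  refine ⟨constantCoeff ∘ v, funext fun i => ?_⟩
  have := congrArg constantCoeff (congrFun hv i)
  rw [Matrix.mulVecLin_apply, c.mu1_eq hE hG, constantCoeff_map_C_mulVec] at this
  simpa using this

/-- Syzygies of `G` lift to syzygies of `E` after multiplication by a power of a variable. -/
theorem exists_pow_smul_eq (hE : resE.IsLinearUpTo m 1) (hG : resG.IsLinearUpTo m 2)
    (hArt : IsArtinian (PolyRing k n)
      (LinearMap.range (resG.d 1).mulVecLin ⧸ LinearMap.range c.nu2)) (i : Fin (n + 1)) :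
    ∃ t : ℕ, ∀ w, resG.d 0 *ᵥ w = 0 → ∃ z, resE.d 0 *ᵥ z = 0 ∧
      c.mu1 *ᵥ z = (X i ^ t : PolyRing k n) • w := by
  obtain ⟨t, ht⟩ := IsArtinian.range_smul_pow_stabilizes
    (LinearMap.range (resG.d 1).mulVecLin ⧸ LinearMap.range c.nu2) (X i : PolyRing k n)
  refine ⟨t, ?_⟩
  -- Degrees are shifted so that `E¹` and `G¹` are generated in degree `0`; the columns of `resG.d
  -- 1` then have degree `1`.
  have hdE : (freeGrading fun _ : Fin (resE.rk 1) => (0 : ℤ)).IsGradedHom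
      (freeGrading fun _ : Fin (resE.rk 0) => (-1 : ℤ)) (resE.d 0).mulVecLin :=
    isGradedHom_mulVecLin fun l j =>
      (isHomogeneousOfDegree_natCast (d := 1)).2 (hE.isHomogeneous_one le_rfl l j)
  have hmu : (freeGrading fun _ : Fin (resE.rk 1) => (0 : ℤ)).IsGradedHom
      (freeGrading fun _ : Fin (resG.rk 1) => (0 : ℤ)) c.mu1.mulVecLin :=
    isGradedHom_mulVecLin fun l j => by
      have := c.mu1_homogeneous l j
      rwa [hE 1 le_rfl, hG 1 (by omega), sub_self] at this
  have hX : ∀ e : ℕ, (X i : PolyRing k n) ^ e ∈ stdGrading k n e := fun e => by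
    simpa using (isHomogeneous_X k i).pow e
  have hcol : ∀ j, ∃ z, resE.d 0 *ᵥ z = 0 ∧
      c.mu1 *ᵥ z = (X i ^ t : PolyRing k n) • (resG.d 1).col j := by
    intro j
    have hj : (resG.d 1).col j ∈ LinearMap.range (resG.d 1).mulVecLin :=
      ⟨Pi.single j 1, by rw [Matrix.mulVecLin_apply, Matrix.mulVec_single_one]⟩
    -- Stabilization gives `X i ^ t • col = X i ^ (t + 1) • w + μ¹ z` with `w`, `z` syzygies. The
    -- plan is to compare parts of degree `t + 1`.
    have h1 : (X i ^ t : PolyRing k n) • (LinearMap.range c.nu2).mkQ ⟨_, hj⟩ ∈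
        LinearMap.range ((X i : PolyRing k n) ^ (t + 1) • LinearMap.id :
          (LinearMap.range (resG.d 1).mulVecLin ⧸ LinearMap.range c.nu2) →ₗ[PolyRing k n] _) := by
      rw [← ht (t + 1) (by omega)]
      exact ⟨(LinearMap.range c.nu2).mkQ ⟨_, hj⟩, rfl⟩
    obtain ⟨q, hq⟩ := h1
    obtain ⟨⟨w, hw⟩, rfl⟩ := Submodule.mkQ_surjective _ q
    have h2 : (LinearMap.range c.nu2).mkQ ((X i ^ t : PolyRing k n) • ⟨_, hj⟩ -
        (X i ^ (t + 1) : PolyRing k n) • ⟨w, hw⟩) = 0 := by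
      rw [map_sub, map_smul, map_smul, ← hq]
      exact sub_self _
    rw [Submodule.mkQ_apply, Submodule.Quotient.mk_eq_zero] at h2
    obtain ⟨⟨z, hz⟩, hz'⟩ := h2
    have hz0 : resE.d 0 *ᵥ z = 0 := by
      rw [resE.exact_succ] at hz
      exact hz
    have hw0 : resG.d 0 *ᵥ w = 0 := by
      rw [resG.exact_succ] at hw
      exact hw
    have hz1 : c.mu1.mulVecLin z =
        (X i ^ t : PolyRing k n) • (resG.d 1).col j - (X i ^ (t + 1) : PolyRing k n) • w :=
      congrArg Subtype.val hz'
    refine ⟨(freeGrading fun _ : Fin (resE.rk 1) => (0 : ℤ)).comp (t + 1) z, ?_, ?_⟩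
    · have h3 := hdE.map_comp (t + 1) z
      rwa [Matrix.mulVecLin_apply, Matrix.mulVecLin_apply, hz0, map_zero] at h3
    · have h3 := hmu.map_comp (t + 1) z
      -- The syzygy `w` has no constant term, so `X i ^ (t + 1) • w` contributes nothing in degree
      -- `t + 1`, and the component of `z` alone lifts `X i ^ t • col`.
      have hcomp : (freeGrading fun _ : Fin (resG.rk 1) => (0 : ℤ)).comp 0 w = 0 := by
        funext l
        rw [freeGrading_comp_apply]
        simp [homogeneousComponentInt, homogeneousComponent_zero, ← constantCoeff_eq,
          resG.constantCoeff_of_mulVec_eq_zero hw0]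
      have h6 := ModuleGrading.comp_smul (freeGrading fun _ : Fin (resG.rk 1) => (0 : ℤ))
        (hX (t + 1)) 0 w
      have hcolmem : (X i ^ t : PolyRing k n) • (resG.d 1).col j ∈
          (freeGrading fun _ : Fin (resG.rk 1) => (0 : ℤ)).piece (t + 1) :=
        ModuleGrading.smul_mem _ (hX t) (mem_freeGrading.2 fun l => by
          rw [sub_zero]
          exact (isHomogeneousOfDegree_natCast (d := 1)).2 (hG.isHomogeneous_one le_rfl l j))
      rw [hcomp, smul_zero, add_zero, Nat.cast_add, Nat.cast_one] at h6
      rw [hz1, map_sub, h6, sub_zero, ModuleGrading.comp_of_mem hcolmem] at h3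
      exact h3
  choose z hz hz' using hcol
  intro w hw
  have hw' : w ∈ LinearMap.range (resG.d 1).mulVecLin := by
    rw [resG.exact_succ]
    exact hw
  obtain ⟨v, rfl⟩ := hw'
  refine ⟨∑ j, v j • z j, ?_, ?_⟩
  · rw [← Matrix.mulVecLin_apply, map_sum]
    refine Finset.sum_eq_zero fun j _ => ?_
    rw [map_smul, Matrix.mulVecLin_apply, hz, smul_zero]
  · rw [← Matrix.mulVecLin_apply, map_sum, Matrix.mulVecLin_apply, mulVec_eq_sum_col,
      Finset.smul_sum]
    refine Finset.sum_congr rfl fun j _ => ?_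
    rw [map_smul, Matrix.mulVecLin_apply, hz', smul_comm]

variable (hμ : gradE.IsGradedHom gradG μ)

/-- The kernel of `μ` is generated in degree `m`. -/
theorem exists_ker_generators (hE : resE.IsLinearUpTo m 1) (hG : resG.IsLinearUpTo m 2)
    (hμ_surj : Function.Surjective μ) (hμ1 : Function.Surjective c.mu1.mulVecLin) :
    ∃ (e : ℕ) (h : Fin e → LinearMap.ker μ), (∀ i, h i ∈ (gradE.ker gradG μ hμ).piece m) ∧
      Function.Surjective (Fintype.linearCombination (PolyRing k n) h) := by
  obtain ⟨T, hT, hT'⟩ := exists_projection_ker (n := n) (c.const0_surjective hE hG hμ_surj)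
  have hker : ∀ i, resE.aug (C ∘ T.col i) ∈ LinearMap.ker μ := by
    intro i
    rw [LinearMap.mem_ker, ← c.aug_mu0, c.mu0_eq hE hG, map_C_mulVec, ← Matrix.mulVec_single_one,
      Matrix.mulVec_mulVec, hT, Matrix.zero_mulVec,
      C_comp_zero, map_zero]
  refine ⟨_, fun i => ⟨_, hker i⟩, fun i => ?_, ?_⟩
  · refine isGradedHom_linearCombination gradE resE.gen_mem _ _ (mem_freeGrading.2 fun l => ?_)
    rw [hE 0 (by omega), Nat.cast_zero, add_zero, sub_self]
    exact (isHomogeneousOfDegree_natCast (d := 0)).2 (isHomogeneous_C _ _)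
  · rintro ⟨x, hx⟩
    obtain ⟨v, rfl⟩ := resE.surjective x
    have h0 : resG.aug (c.mu0 *ᵥ v) = 0 := by
      rw [c.aug_mu0]
      exact hx
    -- Surjectivity of `μ¹` allows `v` to be corrected by a relation of `E`, so that it lies in the
    -- kernel of the constant matrix, onto which `T` projects.
    obtain ⟨w, hw⟩ := resG.exists_mulVec_eq h0
    obtain ⟨w', rfl⟩ := hμ1 w
    rw [Matrix.mulVecLin_apply, c.d_mu1] at hw
    set y := v - resE.d 0 *ᵥ w' with hy
    have hy0 : (c.const0.map C : Matrix _ _ (PolyRing k n)) *ᵥ y = 0 := by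
      rw [← c.mu0_eq hE hG, Matrix.mulVec_sub, hw, sub_self]
    refine ⟨y, Subtype.ext ?_⟩
    have h1 : resE.aug v = resE.aug y := by
      rw [hy, map_sub, resE.aug_mulVec, sub_zero]
    change _ = resE.aug v
    have h2 : resE.aug y = ∑ i, y i • resE.aug (C ∘ T.col i) := by
      conv_lhs => rw [← hT' y hy0, mulVec_eq_sum_col, map_sum]
      exact Finset.sum_congr rfl fun i _ => map_smul _ _ _
    rw [h1, h2, Fintype.linearCombination_apply, AddSubmonoidClass.coe_finsetSum]
    rfl

/-- The generators of a minimal presentation of the kernel of `μ`, in terms of those of `E`. -/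
theorem exists_generator_matrix (hE : resE.IsLinearUpTo m 1) (hG : resG.IsLinearUpTo m 2)
    (P : MinimalPresentation (gradE.ker gradG μ hμ)) (hP : ∀ l, P.deg0 l = m) :
    ∃ Γ : Matrix (Fin (resE.rk 0)) (Fin P.rk0) k,
      (∀ y, (Fintype.linearCombination (PolyRing k n) P.gen y).1 =
        resE.aug ((Γ.map C : Matrix _ _ (PolyRing k n)) *ᵥ y)) ∧
      (∀ v, Γ *ᵥ v = 0 → v = 0) ∧ ∀ v, c.const0 *ᵥ v = 0 ↔ ∃ w, Γ *ᵥ w = v := by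
  have hgen : ∀ l, ∃ v : Fin (resE.rk 0) → k, resE.aug (C ∘ v) = (P.gen l).1 := fun l =>
    exists_constant_linearCombination_eq (ℳ := gradE) (m := m) (fun j => by
      have := resE.gen_mem j
      rwa [hE 0 (by omega), Nat.cast_zero, add_zero] at this) resE.surjective
      (by
        have := P.gen_mem l
        rw [hP] at this
        exact this)
  choose Γ hΓ using hgen
  have hΓaug : ∀ y, (Fintype.linearCombination (PolyRing k n) P.gen y).1 =
      resE.aug (((Matrix.of Γ)ᵀ.map C : Matrix _ _ (PolyRing k n)) *ᵥ y) := by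
    intro y
    rw [Fintype.linearCombination_apply, AddSubmonoidClass.coe_finsetSum, mulVec_eq_sum_col,
      map_sum]
    refine Finset.sum_congr rfl fun l _ => ?_
    have h2 : ((Matrix.of Γ)ᵀ.map C : Matrix _ _ (PolyRing k n)).col l = C ∘ Γ l := rfl
    rw [h2, map_smul, hΓ]
    rfl
  have hC : ∀ v : Fin P.rk0 → k, ∀ i, constantCoeff ((C ∘ v : Fin P.rk0 → PolyRing k n) i) = v i :=
    fun v i => by simp
  refine ⟨(Matrix.of Γ)ᵀ, hΓaug, fun v hv => ?_, fun v => ⟨fun hv => ?_, ?_⟩⟩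
  · have h0 : (C ∘ v : Fin P.rk0 → PolyRing k n) ∈ LinearMap.range P.mat.mulVecLin := by
      rw [P.exact, LinearMap.mem_ker]
      refine Subtype.ext ?_
      rw [hΓaug, map_C_mulVec, hv, C_comp_zero, map_zero]
      rfl
    obtain ⟨w, hw⟩ := h0
    funext l
    rw [← hC v l, ← hw]
    exact constantCoeff_mulVec_eq_zero P.mat_minimal w l
  · have h0 : resE.aug (C ∘ v) ∈ LinearMap.ker μ := by
      rw [LinearMap.mem_ker, ← c.aug_mu0, c.mu0_eq hE hG, map_C_mulVec, hv, C_comp_zero, map_zero]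
    obtain ⟨y, hy⟩ := P.surjective ⟨_, h0⟩
    -- This difference is a relation of `E`, hence has no constant term; the constant part of `y` is
    -- the required preimage.
    have h1 : resE.aug (((Matrix.of Γ)ᵀ.map C : Matrix _ _ (PolyRing k n)) *ᵥ y - C ∘ v) = 0 := by
      rw [map_sub, ← hΓaug, hy, sub_self]
    refine ⟨constantCoeff ∘ y, funext fun i => ?_⟩
    have := resE.constantCoeff_of_aug_eq_zero h1 i
    rw [Pi.sub_apply, map_sub, constantCoeff_map_C_mulVec, sub_eq_zero] at this
    simpa using this
  · rintro ⟨w, rfl⟩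
    have h0 : resG.aug (C ∘ (c.const0 *ᵥ ((Matrix.of Γ)ᵀ *ᵥ w))) = 0 := by
      rw [← map_C_mulVec, ← map_C_mulVec, ← c.mu0_eq hE hG, c.aug_mu0, ← hΓaug]
      exact (Fintype.linearCombination (PolyRing k n) P.gen (C ∘ w)).2
    funext i
    simpa using resG.constantCoeff_of_aug_eq_zero h0 i

/-- The linear relations of a minimal presentation of the kernel of `μ`, in terms of those
of `E`. -/
theorem exists_relation_matrix (hE : resE.IsLinearUpTo m 1) (hG : resG.IsLinearUpTo m 2)
    (hμ_surj : Function.Surjective μ)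
    (P : MinimalPresentation (gradE.ker gradG μ hμ)) (hP : ∀ l, P.deg0 l = m)
    {Γ : Matrix (Fin (resE.rk 0)) (Fin P.rk0) k}
    (hΓaug : ∀ y, (Fintype.linearCombination (PolyRing k n) P.gen y).1 =
        resE.aug ((Γ.map C : Matrix _ _ (PolyRing k n)) *ᵥ y))
    (hΓinj : ∀ v, Γ *ᵥ v = 0 → v = 0) (hΓker : ∀ v, c.const0 *ᵥ v = 0 ↔ ∃ w, Γ *ᵥ w = v) :
    ∃ Ω : Matrix (Fin (resE.rk 1)) {j : Fin P.rk1 // P.deg1 j = m + 1} k,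
      resE.d 0 * (Ω.map C : Matrix _ _ (PolyRing k n)) =
        (Γ.map C : Matrix _ _ (PolyRing k n)) * P.mat.submatrix id Subtype.val ∧
      (∀ v, Ω *ᵥ v = 0 → v = 0) ∧ ∀ v, c.const1 *ᵥ v = 0 ↔ ∃ w, Ω *ᵥ w = v := by
  set A : Matrix (Fin P.rk0) {j : Fin P.rk1 // P.deg1 j = m + 1} (PolyRing k n) :=
    P.mat.submatrix id Subtype.val with hA
  have hAhom : ∀ l j, (A l j).IsHomogeneous 1 := fun l j => by
    have := P.mat_homogeneous l j
    rw [hP, j.2, add_sub_cancel_left] at this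
    exact (isHomogeneousOfDegree_natCast (d := 1)).1 this
  have hdE : ∀ l j, (resE.d 0 l j).IsHomogeneous 1 := hE.isHomogeneous_one le_rfl
  have hmulhom : ∀ {ι κ : Type} [Fintype κ] (B : Matrix ι κ k) (v : κ → PolyRing k n),
      (∀ j, (v j).IsHomogeneous 1) →
      ∀ i, (((B.map C : Matrix ι κ (PolyRing k n)) *ᵥ v) i).IsHomogeneous 1 := by
    intro ι κ _ B v hv i
    refine IsHomogeneous.sum _ _ _ fun j _ => ?_
    have := (isHomogeneous_C (Fin (n + 1)) (B i j)).mul (hv j)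
    rwa [zero_add] at this
  -- A linear relation of the kernel is, through `Γ`, a linear relation of `E`, hence a constant
  -- combination of the columns of `resE.d 0`.
  have hcol : ∀ j, ∃ w : Fin (resE.rk 1) → k,
      resE.d 0 *ᵥ (C ∘ w) = (Γ.map C : Matrix _ _ (PolyRing k n)) *ᵥ A.col j := by
    intro j
    have h0 : A.col j ∈ LinearMap.ker (Fintype.linearCombination (PolyRing k n) P.gen) := by
      rw [← P.exact]
      refine ⟨Pi.single j.1 1, ?_⟩
      rw [Matrix.mulVecLin_apply, Matrix.mulVec_single_one]
      rfl
    have h1 : resE.aug ((Γ.map C : Matrix _ _ (PolyRing k n)) *ᵥ A.col j) = 0 := by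
      rw [← hΓaug, LinearMap.mem_ker.1 h0]
      rfl
    obtain ⟨w, hw⟩ := resE.exists_mulVec_eq h1
    rw [← hw]
    refine exists_constant_mulVec_eq hdE ?_
    rw [hw]
    exact hmulhom _ _ fun l => hAhom l j
  choose Ω hΩ using hcol
  have hΩA : resE.d 0 * ((Matrix.of Ω)ᵀ.map C : Matrix _ _ (PolyRing k n)) =
      (Γ.map C : Matrix _ _ (PolyRing k n)) * A := by
    refine Matrix.ext_of_mulVec_single fun j => ?_
    rw [← Matrix.mulVec_mulVec, ← Matrix.mulVec_mulVec, Matrix.mulVec_single_one A, ← hΩ,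
      Matrix.mulVec_single_one]
    rfl
  have hΩA' : ∀ v : {j : Fin P.rk1 // P.deg1 j = m + 1} → k,
      resE.d 0 *ᵥ (C ∘ ((Matrix.of Ω)ᵀ *ᵥ v)) =
        (Γ.map C : Matrix _ _ (PolyRing k n)) *ᵥ (A *ᵥ (C ∘ v)) := by
    intro v
    rw [← map_C_mulVec, Matrix.mulVec_mulVec, hΩA, Matrix.mulVec_mulVec]
  refine ⟨(Matrix.of Ω)ᵀ, hΩA, fun v hv => ?_, fun v => ⟨fun hv => ?_, ?_⟩⟩
  · refine P.linear_columns_injective v (map_C_mulVec_injective hΓinj _ ?_)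
    rw [← hΩA', hv, C_comp_zero, Matrix.mulVec_zero]
  -- Conversely, if `const1` kills `v`, the relation `resE.d 0 v` of `E` lies in the kernel of `μ⁰`.
  -- It therefore factors through `Γ` as a linear relation of the kernel of `μ`.
  · have h0 : (c.const0.map C : Matrix _ _ (PolyRing k n)) *ᵥ (resE.d 0 *ᵥ (C ∘ v)) = 0 := by
      rw [← c.mu0_eq hE hG, ← c.d_mu1, c.mu1_eq hE hG, map_C_mulVec, hv,
        C_comp_zero, Matrix.mulVec_zero]
    obtain ⟨T, hT⟩ := exists_map_C_mulVec_eq (n := n) (c.const0_surjective hE hG hμ_surj)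
      fun v hv => (hΓker v).1 hv
    have h1 := hT _ h0
    set y := (T.map C : Matrix _ _ (PolyRing k n)) *ᵥ (resE.d 0 *ᵥ (C ∘ v))
    have hy : ∀ l, (y l).IsHomogeneous 1 := hmulhom _ _ fun l => by
      refine IsHomogeneous.sum _ _ _ fun j _ => ?_
      exact (hdE l j).mul (isHomogeneous_C (Fin (n + 1)) (v j))
    have hy' : Fintype.linearCombination (PolyRing k n) P.gen y = 0 := by
      refine Subtype.ext ?_
      rw [hΓaug, h1, resE.aug_mulVec]
      rfl
    obtain ⟨w, hw⟩ := P.exists_linear_relation hP hy hy'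
    refine ⟨w, ?_⟩
    have h2 : resE.d 0 *ᵥ (C ∘ ((Matrix.of Ω)ᵀ *ᵥ w) - C ∘ v) = 0 := by
      rw [Matrix.mulVec_sub, hΩA', hw, h1, sub_self]
    funext i
    have := resE.constantCoeff_of_mulVec_eq_zero h2 i
    rw [Pi.sub_apply, map_sub, sub_eq_zero] at this
    simpa using this
  · rintro ⟨w, rfl⟩
    have h0 : resG.d 0 *ᵥ (C ∘ (c.const1 *ᵥ ((Matrix.of Ω)ᵀ *ᵥ w))) = 0 := by
      have h1 : c.const0 * Γ = 0 := Matrix.ext_of_mulVec_single fun i => by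
        rw [← Matrix.mulVec_mulVec, (hΓker _).2 ⟨_, rfl⟩, Matrix.zero_mulVec]
      rw [← map_C_mulVec, ← c.mu1_eq hE hG, c.d_mu1, hΩA', c.mu0_eq hE hG, Matrix.mulVec_mulVec,
        ← Matrix.map_mul, h1, Matrix.map_zero _ (map_zero _), Matrix.zero_mulVec]
    funext i
    simpa using resG.constantCoeff_of_mulVec_eq_zero h0 i

end MinimalFreeResolution.Lift

/-! ### Ranks of the presentation matrices at a point. -/

namespace MinimalFreeResolution

open Matrix MvPolynomial

variable {k : Type u} [Field k] {n : ℕ} {M : Type u} [AddCommGroup M] [Module (PolyRing k n) M]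
  {ℳ : ModuleGrading (stdGrading k n) M} {P : MinimalFreeResolution ℳ} {m : ℤ}

theorem IsLinearUpTo.gen_mem (h : P.IsLinearUpTo m 1) (l : Fin (P.rk 0)) :
    P.gen l ∈ ℳ.piece m := by
  have := P.gen_mem l
  rwa [h 0 (by omega), Nat.cast_zero, add_zero] at this

theorem IsLinearUpTo.mono {N N' : ℕ} (h : P.IsLinearUpTo m N) (hN : N' ≤ N) :
    P.IsLinearUpTo m N' :=
  fun i hi => h i (hi.trans hN)

theorem IsLinearUpTo.rank_add (h : P.IsLinearUpTo m 1) {r : ℕ}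
    (hr : IsVectorBundleOfRank (ProjTilde.tilde ℳ) r) {p : Fin (n + 1) → k} (hp : p ≠ 0) :
    ((P.d 0).map (eval p)).rank + r = P.rk 0 :=
  rank_eval_add h.gen_mem (h.isHomogeneous_one le_rfl) P.surjective P.exact_zero hr hp

namespace Lift

variable {N : Type u} [AddCommGroup N] [Module (PolyRing k n) N]
  {𝒩 : ModuleGrading (stdGrading k n) N} {Q : MinimalFreeResolution 𝒩} {μ : M →ₗ[PolyRing k n] N}
  (c : Lift P Q μ)

theorem d_eval_mul (hP : P.IsLinearUpTo m 1) (hQ : Q.IsLinearUpTo m 2) (p : Fin (n + 1) → k) :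
    (Q.d 0).map (eval p) * c.const1 = c.const0 * (P.d 0).map (eval p) := by
  have h := congrArg (fun D => D.map (eval p)) c.comm_one
  rw [c.mu0_eq hP hQ, c.mu1_eq hP hQ] at h
  simpa only [Matrix.map_mul, map_C_map_eval] using h

/-- The image at a point of the constant vectors annihilated by `μ¹`. -/
theorem map_ker_const1_eq (hP : P.IsLinearUpTo m 1) (hQ : Q.IsLinearUpTo m 2)
    {s : ℕ} (hs : IsVectorBundleOfRank (ProjTilde.tilde 𝒩) s)
    (hArt : IsArtinian (PolyRing k n)
      (LinearMap.range (Q.d 1).mulVecLin ⧸ LinearMap.range c.nu2))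
    {p : Fin (n + 1) → k} (hp : p ≠ 0) :
    (LinearMap.ker c.const1.mulVecLin).map ((P.d 0).map (eval p)).mulVecLin =
      (LinearMap.ker (c.const0 * (P.d 0).map (eval p)).mulVecLin).map
        ((P.d 0).map (eval p)).mulVecLin := by
  apply le_antisymm
  · refine Submodule.map_mono fun v hv => ?_
    rw [LinearMap.mem_ker, Matrix.mulVecLin_apply] at hv ⊢
    rw [← c.d_eval_mul hP hQ, ← Matrix.mulVec_mulVec, hv, Matrix.mulVec_zero]
  · rintro _ ⟨v, hv, rfl⟩
    rw [SetLike.mem_coe, LinearMap.mem_ker, Matrix.mulVecLin_apply, ← c.d_eval_mul hP hQ,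
      ← Matrix.mulVec_mulVec] at hv
    -- `const1 v` lies in the kernel of `Q.d 0` at `p`, so it is the value of a syzygy `w`; a
    -- multiple by a power of a variable nonzero at `p` lifts to `z`.
    obtain ⟨w, hw, hwp⟩ := exists_syzygy_eval_eq (hQ.mono one_le_two).gen_mem
      (hQ.isHomogeneous_one one_le_two) Q.surjective Q.exact_zero hs hp _ hv
    obtain ⟨i, hi⟩ := Function.ne_iff.1 hp
    obtain ⟨t, ht⟩ := c.exists_pow_smul_eq hP hQ hArt i
    obtain ⟨z, hz, hzw⟩ := ht w hw
    have hpt : p i ^ t ≠ 0 := pow_ne_zero _ hi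
    have hzp : (P.d 0).map (eval p) *ᵥ (eval p ∘ z) = 0 := by
      funext l
      rw [← RingHom.map_mulVec, hz]
      simp
    have hz1 : c.const1 *ᵥ (eval p ∘ z) = p i ^ t • (c.const1 *ᵥ v) := by
      funext l
      have h := congrArg (eval p) (congrFun hzw l)
      rw [c.mu1_eq hP hQ, eval_map_C_mulVec] at h
      rw [h]
      simp [hwp]
    -- The value of `z` at `p` is killed by `P.d 0` and mapped by `const1` to `p i ^ t` times
    -- `const1 v`.
    refine ⟨v - (p i ^ t)⁻¹ • (eval p ∘ z), ?_, ?_⟩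
    · rw [SetLike.mem_coe, LinearMap.mem_ker, Matrix.mulVecLin_apply, Matrix.mulVec_sub,
        Matrix.mulVec_smul, hz1, smul_smul, inv_mul_cancel₀ hpt, one_smul, sub_self]
    · rw [Matrix.mulVecLin_apply, Matrix.mulVecLin_apply, Matrix.mulVec_sub, Matrix.mulVec_smul,
        hzp, smul_zero, sub_zero]

/-- After replacing `ker const1` by the kernel of `const0 * d_P(p)`, this is rank-nullity: that
product equals `d_Q(p) * const1`, whose range is that of `d_Q(p)` because `const1` is surjective. -/
theorem finrank_map_ker_const1 (hP : P.IsLinearUpTo m 1) (hQ : Q.IsLinearUpTo m 2)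
    (hμ1 : Function.Surjective c.mu1.mulVecLin) {s : ℕ}
    (hs : IsVectorBundleOfRank (ProjTilde.tilde 𝒩) s)
    (hArt : IsArtinian (PolyRing k n)
      (LinearMap.range (Q.d 1).mulVecLin ⧸ LinearMap.range c.nu2))
    {p : Fin (n + 1) → k} (hp : p ≠ 0) :
    Module.finrank k ((LinearMap.ker c.const1.mulVecLin).map
      ((P.d 0).map (eval p)).mulVecLin) + ((Q.d 0).map (eval p)).rank =
        ((P.d 0).map (eval p)).rank := by
  have h1 := finrank_map_add_finrank_ker_of_le ((P.d 0).map (eval p)).mulVecLin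
    (LinearMap.ker (c.const0 * (P.d 0).map (eval p)).mulVecLin) (fun v hv => by
      rw [LinearMap.mem_ker, Matrix.mulVecLin_apply] at hv ⊢
      rw [← Matrix.mulVec_mulVec, hv, Matrix.mulVec_zero])
  have h2 := LinearMap.finrank_range_add_finrank_ker
    (c.const0 * (P.d 0).map (eval p)).mulVecLin
  have h3 := LinearMap.finrank_range_add_finrank_ker ((P.d 0).map (eval p)).mulVecLin
  have h4 : LinearMap.range (c.const0 * (P.d 0).map (eval p)).mulVecLin =
      LinearMap.range ((Q.d 0).map (eval p)).mulVecLin := by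
    rw [← c.d_eval_mul hP hQ, Matrix.mulVecLin_mul, LinearMap.range_comp_of_range_eq_top]
    exact LinearMap.range_eq_top.2 (c.const1_surjective hP hQ hμ1)
  rw [h4] at h2
  rw [c.map_ker_const1_eq hP hQ hs hArt hp, Matrix.rank, Matrix.rank]
  omega

end Lift

end MinimalFreeResolution

end

/-! ### Betti numbers and constant corank of the linear part. -/

theorem theorem1p2 {k : Type u} [Field k] [IsAlgClosed k] (hchar : ringChar k ≠ 2) (n : ℕ)
    {E G : Type u} [AddCommGroup E] [Module (PolyRing k n) E]
    [AddCommGroup G] [Module (PolyRing k n) G]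
    (gradE : ModuleGrading (stdGrading k n) E) (gradG : ModuleGrading (stdGrading k n) G)
    (resE : MinimalFreeResolution gradE) (resG : MinimalFreeResolution gradG)
    (m : ℤ) (hE : resE.IsLinearUpTo m 1) (hG : resG.IsLinearUpTo m 2)
    (μ : E →ₗ[PolyRing k n] G) (hμ : gradE.IsGradedHom gradG μ)
    (hμ_surj : Function.Surjective μ)
    (c : MinimalFreeResolution.Lift resE resG μ)
    (hμ1_surj : Function.Surjective c.mu1.mulVecLin)
    (r s : ℕ)
    (hEr : IsVectorBundleOfRank (ProjTilde.tilde gradE) r)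
    (hGs : IsVectorBundleOfRank (ProjTilde.tilde gradG) s)
    (hArt : IsArtinian (PolyRing k n)
      (LinearMap.range (resG.d 1).mulVecLin ⧸ LinearMap.range c.nu2)) :
    Nonempty (MinimalPresentation (gradE.ker gradG μ hμ)) ∧
    (∀ P : MinimalPresentation (gradE.ker gradG μ hμ),
      (∀ l, P.deg0 l = m) ∧
      (Fintype.card {l : Fin P.rk0 // P.deg0 l = m} : ℤ) =
        (resE.betti 0 m : ℤ) - (resG.betti 0 m : ℤ) ∧
      (Fintype.card {j : Fin P.rk1 // P.deg1 j = m + 1} : ℤ) =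
        (resE.betti 1 (m + 1) : ℤ) - (resG.betti 1 (m + 1) : ℤ) ∧
      (∀ l j, (P.linearPart m l j).IsHomogeneous 1) ∧
      (∀ p : Fin (n + 1) → k, p ≠ 0 →
        (Fintype.card {l : Fin P.rk0 // P.deg0 l = m} : ℤ) -
          (((P.linearPart m).map (MvPolynomial.eval p)).rank : ℤ) = (r : ℤ) - (s : ℤ))) ∧
    (∃ e : ProjTilde.tilde (gradE.ker gradG μ hμ) ≅
        CategoryTheory.Limits.kernel (ProjTilde.tildeMap gradE gradG μ hμ),
      e.hom ≫ CategoryTheory.Limits.kernel.ι (ProjTilde.tildeMap gradE gradG μ hμ) =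
        ProjTilde.tildeMap (gradE.ker gradG μ hμ) gradE (LinearMap.ker μ).subtype
          (gradE.isGradedHom_ker_subtype gradG μ hμ)) := by
  have hfin : Module.Finite (PolyRing k n) E := Module.Finite.of_surjective _ resE.surjective
  refine ⟨nonempty_minimalPresentation _, fun P => ?_, ProjTilde.exists_iso_kernel hμ⟩
  obtain ⟨_, h, hh, hsurj⟩ := c.exists_ker_generators hμ hE hG hμ_surj hμ1_surj
  have hdeg : ∀ l, P.deg0 l = m := P.deg0_eq hh hsurj
  obtain ⟨Γ, hΓaug, hΓinj, hΓker⟩ := c.exists_generator_matrix hμ hE hG P hdeg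
  obtain ⟨Ω, hΩ, hΩinj, hΩker⟩ :=
    c.exists_relation_matrix hμ hE hG hμ_surj P hdeg hΓaug hΓinj hΓker
  have hcard : Fintype.card {l : Fin P.rk0 // P.deg0 l = m} = P.rk0 := by
    rw [Fintype.card_congr (Equiv.subtypeUnivEquiv hdeg), Fintype.card_fin]
  have hcard0 := card_add_card_of_exact (c.const0_surjective hE hG hμ_surj) hΓinj hΓker
  have hcard1 := card_add_card_of_exact (c.const1_surjective hE hG hμ1_surj) hΩinj hΩker
  have hbE0 := hE.betti_eq (i := 0) (by omega)
  have hbG0 := hG.betti_eq (i := 0) (by omega)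
  have hbE1 := hE.betti_eq (i := 1) le_rfl
  have hbG1 := hG.betti_eq (i := 1) one_le_two
  simp only [Fintype.card_fin] at hcard0 hcard1
  rw [Nat.cast_zero, add_zero] at hbE0 hbG0
  rw [Nat.cast_one] at hbE1 hbG1
  rw [hcard, hbE0, hbG0, hbE1, hbG1]
  refine ⟨hdeg, by omega, by omega, fun l j => ?_, fun p hp => ?_⟩
  · have := P.mat_homogeneous l.1 j.1
    rw [l.2, j.2, add_sub_cancel_left] at this
    exact (isHomogeneousOfDegree_natCast (d := 1)).1 this
  · set A := P.mat.submatrix id (Subtype.val : {j : Fin P.rk1 // P.deg1 j = m + 1} → Fin P.rk1)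
      with hA
    have h1 : ((P.linearPart m).map (MvPolynomial.eval p)).rank =
        (A.map (MvPolynomial.eval p)).rank :=
      Matrix.rank_submatrix (A.map (MvPolynomial.eval p)) (Equiv.subtypeUnivEquiv hdeg)
        (Equiv.refl _)
    have h2 : (resE.d 0).map (MvPolynomial.eval p) * Ω = Γ * A.map (MvPolynomial.eval p) := by
      have h := congrArg (fun D => D.map (MvPolynomial.eval p)) hΩ
      simpa only [Matrix.map_mul, map_C_map_eval] using h
    -- Composing with the injective `Γ` preserves the rank, and `Γ A(p) = d_E(p) Ω` with the range
    -- of `Ω` equal to `ker const1`.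
    have h3 : (A.map (MvPolynomial.eval p)).rank = Module.finrank k
        ((LinearMap.ker c.const1.mulVecLin).map
          ((resE.d 0).map (MvPolynomial.eval p)).mulVecLin) := by
      have hrange : LinearMap.range Ω.mulVecLin = LinearMap.ker c.const1.mulVecLin := by
        ext v
        exact (hΩker v).symm
      rw [← rank_mul_of_injective hΓinj, ← h2, Matrix.rank, Matrix.mulVecLin_mul,
        LinearMap.range_comp, hrange]
    have h4 := c.finrank_map_ker_const1 hE hG hμ1_surj hGs hArt hp
    have h5 := hE.rank_add hEr hp
    have h6 := (hG.mono one_le_two).rank_add hGs hp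
    -- What remains is arithmetic: `rank A(p) = (rk E⁰ - r) - (rk G⁰ - s)`, subtracted from `rk E⁰ -
    -- rk G⁰`.
    rw [h1, h3]
    omega
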